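/- All graphs are finite and simple. A graph $G$ is perfect if $\chi(H)=\omega(H)$ for every induced subgraph $H$ of $G$ (chromatic number equals maximum clique size). A pure pair in $G$ is a pair $A,B$ of disjoint subsets of $V(G)$ such that either every vertex of $A$ is adjacent to every vertex of $B$, or no vertex of $A$ is adjacent to a vertex of $B$. For every real $c>0$ there exists $N$ such that for every integer $n\ge N$, every $n$-vertex perfect graph $G$ has a pure pair $A,B$ with $|A|,|B|\ge n^{1-c}$. Consequently Fox's conjecture holds: there is a function $\delta:\mathbb{N}\to\mathbb{R}$ with $\delta(n)\to 0$ as $n\to\infty$ such that, for all sufficiently large $n$, every $n$-vertex perfect graph $G$ has a pure pair $A,B$ with $|A|,|B|\ge n^{1-\delta(n)}$. -/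

import Mathlib

open Filter Topology

universe u

namespace SimpleGraph

/-- A graph is perfect if, in each of its induced subgraphs (the graph itself included), the
chromatic number equals the largest size of a clique. -/
def IsPerfect {V : Type*} (G : SimpleGraph V) : Prop :=
  ∀ X : Set V, (G.induce X).chromaticNumber = ((G.induce X).cliqueNum : ℕ∞)

/-- Every vertex of `A` is adjacent to every vertex of `B`. -/
def CompleteTo {V : Type*} (G : SimpleGraph V) (A B : Finset V) : Prop :=
  ∀ a ∈ A, ∀ b ∈ B, G.Adj a b

/-- No vertex of `A` has a neighbour in `B`. -/
def AnticompleteTo {V : Type*} (G : SimpleGraph V) (A B : Finset V) : Prop :=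
  ∀ a ∈ A, ∀ b ∈ B, ¬ G.Adj a b

/-- A pure pair: two disjoint vertex sets that are complete or anticomplete to each other. -/
def IsPurePair {V : Type*} (G : SimpleGraph V) (A B : Finset V) : Prop :=
  Disjoint A B ∧ (G.CompleteTo A B ∨ G.AnticompleteTo A B)

end SimpleGraph

/-! A perfect graph satisfies |X| ≤ ω(X)α(X) for every vertex set X (`CliqueIndepBound`). This
inequality is self-complementary and fails on odd cycles of length at least 5, so neither the graph
nor its complement has an odd hole, and the perfect graph theorem is not needed. Excluding the
pentagon already yields a set W of linear size that is very sparse or very dense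
(`exists_sparse_or_dense`). After complementing if necessary, it remains to find two anticomplete
sets of size m ≈ n^(1-c) in a sparse graph without odd holes (`OddHoleFree.not_edgeBetween`).

Suppose there are none. Then m vertices have neighbours in almost every other large set. Hence some
vertex reaches m vertices within K ≈ 2/c steps, where each step gains a factor D ≈ n^(c/2), and
connected sets T 0 ⊆ … ⊆ T k can be grown with closed neighbourhoods of prescribed linear sizes. Let
Z be the set of vertices outside all these neighbourhoods, and let x be a vertex attached to T 0
that reaches m vertices of Z. The j-th block consists of vertices that see T j but not T (j - 1).
Most of them are at distance between 2 and K + 1 from x through Z, so by pigeonhole K + 2 blocks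
contain many vertices at one common distance l.

Let y, y' be adjacent, y in a higher of these blocks than y', and let q precede y on a shortest path
from x. If q were not adjacent to y', then y' would be joined to x by induced paths of lengths l and
l + 1, and closing both with one path through the T of the block of y' would give holes of both
parities (`OddHoleFree.adj_of_shortest`). So adjacency to q spreads from block to block. Expansion
down the K + 2 blocks then makes q adjacent to more vertices than the maximum degree allows. -/

namespace SimpleGraph

/-! ### Perfect graphs and their complements have no odd holes. -/

variable {V : Type*}

/-- The vertices `f 0, …, f (l - 1)` form, in this cyclic order, an induced cycle of `G`. -/
def IsHole (G : SimpleGraph V) (l : ℕ) (f : ℕ → V) : Prop :=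
  ∀ i j, i < j → j < l → f i ≠ f j ∧ (G.Adj (f i) (f j) ↔ j = i + 1 ∨ (i = 0 ∧ j + 1 = l))

/-- No induced cycle of odd length at least five. -/
def OddHoleFree (G : SimpleGraph V) : Prop :=
  ∀ l f, 5 ≤ l → Odd l → ¬ G.IsHole l f

/-- Lovász' inequality: every finite vertex set is at most as large as the product of the sizes of
some clique and some independent set in it. -/
def CliqueIndepBound (G : SimpleGraph V) : Prop :=
  ∀ X : Finset V, ∃ Q S : Finset V, Q ⊆ X ∧ S ⊆ X ∧
    (∀ a ∈ Q, ∀ b ∈ Q, a ≠ b → G.Adj a b) ∧ (∀ a ∈ S, ∀ b ∈ S, ¬ G.Adj a b) ∧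
    X.card ≤ Q.card * S.card

/-- Cliques and independent sets swap roles. This symmetry is what lets the dense case be treated in
the complement. -/
theorem CliqueIndepBound.compl {G : SimpleGraph V} (h : G.CliqueIndepBound) :
    Gᶜ.CliqueIndepBound := by
  intro X
  obtain ⟨Q, S, hQ, hS, h1, h2, h3⟩ := h X
  refine ⟨S, Q, hS, hQ, ?_, ?_, by rwa [mul_comm]⟩
  · intro a ha b hb hab
    exact (compl_adj _ _ _).2 ⟨hab, h2 a ha b hb⟩
  · intro a ha b hb hab
    obtain ⟨hne, hn⟩ := (compl_adj _ _ _).1 hab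
    exact hn (h1 a ha b hb hne)

/-- In a colouring with ω colours some colour class has at least the average size |X|/ω; pair it
with a maximum clique. -/
theorem IsPerfect.cliqueIndepBound [Finite V] {G : SimpleGraph V} (h : G.IsPerfect) :
    G.CliqueIndepBound := by
  classical
  intro X
  have hX := h (X : Set V)
  set H := G.induce (X : Set V) with hH
  obtain ⟨Q, hQ⟩ := H.exists_isNClique_cliqueNum
  have hcol : H.Colorable H.cliqueNum :=
    chromaticNumber_le_iff_colorable.1 hX.le
  obtain ⟨C⟩ := hcol
  have hcard : (Finset.univ : Finset (X : Set V)).card = X.card := by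
    simp
  rcases X.eq_empty_or_nonempty with rfl | hne
  · exact ⟨∅, ∅, by simp⟩
  obtain ⟨x0, hx0⟩ := hne
  have hpos : 0 < H.cliqueNum := Fin.pos (C ⟨x0, hx0⟩)
  obtain ⟨i, hi⟩ : ∃ i : Fin H.cliqueNum, X.card ≤
      H.cliqueNum * (Finset.univ.filter (fun v : (X : Set V) => C v = i)).card := by
    by_contra hcon
    push Not at hcon
    have hsum : X.card = ∑ i : Fin H.cliqueNum,
        (Finset.univ.filter (fun v : (X : Set V) => C v = i)).card := by
      rw [← hcard]
      exact Finset.card_eq_sum_card_fiberwise (fun _ _ => Finset.mem_coe.2 (Finset.mem_univ _))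
    have : ∑ i : Fin H.cliqueNum, H.cliqueNum *
        (Finset.univ.filter (fun v : (X : Set V) => C v = i)).card <
        ∑ i : Fin H.cliqueNum, X.card :=
      Finset.sum_lt_sum_of_nonempty ⟨⟨0, hpos⟩, Finset.mem_univ _⟩ (fun i _ => hcon i)
    rw [← Finset.mul_sum, ← hsum] at this
    simp at this
  refine ⟨Q.map (Function.Embedding.subtype _),
    (Finset.univ.filter (fun v : (X : Set V) => C v = i)).map (Function.Embedding.subtype _),
    ?_, ?_, ?_, ?_, ?_⟩
  · intro a ha
    obtain ⟨b, -, rfl⟩ := Finset.mem_map.1 ha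
    exact b.2
  · intro a ha
    obtain ⟨b, -, rfl⟩ := Finset.mem_map.1 ha
    exact b.2
  · intro a ha b hb hab
    obtain ⟨a', ha', rfl⟩ := Finset.mem_map.1 ha
    obtain ⟨b', hb', rfl⟩ := Finset.mem_map.1 hb
    have := hQ.isClique ha' hb' (by rintro rfl; exact hab rfl)
    exact this
  · intro a ha b hb hab
    obtain ⟨a', ha', rfl⟩ := Finset.mem_map.1 ha
    obtain ⟨b', hb', rfl⟩ := Finset.mem_map.1 hb
    have hadj : H.Adj a' b' := hab
    exact C.valid hadj ((Finset.mem_filter.1 ha').2.trans (Finset.mem_filter.1 hb').2.symm)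
  · rw [Finset.card_map, Finset.card_map, hQ.card_eq]
    exact hi

theorem IsHole.injOn {G : SimpleGraph V} {l : ℕ} {f : ℕ → V} (h : G.IsHole l f) :
    Set.InjOn f (Finset.range l : Set ℕ) := by
  intro i hi j hj hij
  simp only [Finset.coe_range, Set.mem_Iio] at hi hj
  rcases lt_trichotomy i j with hlt | rfl | hlt
  · exact absurd hij (h i j hlt hj).1
  · rfl
  · exact absurd hij.symm (h j i hlt hi).1

/-- A set of indices of a cycle, no two of them consecutive, has at most half of all the
indices. -/
theorem two_mul_card_le_of_not_consecutive {l : ℕ} (hl : 1 ≤ l) {I : Finset ℕ}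
    (hI : I ⊆ Finset.range l) (h1 : ∀ i ∈ I, i + 1 ∉ I) (h2 : ¬ (0 ∈ I ∧ l - 1 ∈ I)) :
    2 * I.card ≤ l := by
  classical
  -- The cyclic successor: `I` and its shift are disjoint sets of indices of equal size.
  set g : ℕ → ℕ := fun i => if i + 1 = l then 0 else i + 1 with hg
  have hinj : Set.InjOn g (I : Set ℕ) := by
    intro i hi j hj hij
    simp only [hg] at hij
    split_ifs at hij <;> omega
  have hdisj : Disjoint I (I.image g) := by
    rw [Finset.disjoint_left]
    intro i hi hi'
    obtain ⟨j, hj, rfl⟩ := Finset.mem_image.1 hi'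
    simp only [hg] at hi
    split_ifs at hi with hjl
    · exact h2 ⟨hi, by rwa [← hjl, Nat.add_sub_cancel]⟩
    · exact h1 j hj hi
  have hsub : I ∪ I.image g ⊆ Finset.range l := by
    refine Finset.union_subset hI ?_
    intro i hi
    obtain ⟨j, hj, rfl⟩ := Finset.mem_image.1 hi
    have := Finset.mem_range.1 (hI hj)
    simp only [hg, Finset.mem_range]
    split_ifs <;> omega
  have := Finset.card_le_card hsub
  rw [Finset.card_union_of_disjoint hdisj, Finset.card_image_of_injOn hinj,
    Finset.card_range] at this
  omega

/-- In a cycle of odd length l ≥ 5 cliques have at most 2 vertices and independent sets at most (l -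
1)/2, so the product is at most l - 1. -/
theorem CliqueIndepBound.oddHoleFree {G : SimpleGraph V} (h : G.CliqueIndepBound) :
    G.OddHoleFree := by
  classical
  intro l f hl hodd hole
  obtain ⟨Q, S, hQ, hS, hQc, hSi, hcard⟩ := h ((Finset.range l).image f)
  rw [Finset.card_image_of_injOn hole.injOn, Finset.card_range] at hcard
  have hQ2 : Q.card ≤ 2 := by
    by_contra hcon
    obtain ⟨a, ha, b, hb, c, hc, hab, hac, hbc⟩ := Finset.two_lt_card.1 (not_le.1 hcon)
    obtain ⟨i, hi, rfl⟩ := Finset.mem_image.1 (hQ ha)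
    obtain ⟨j, hj, rfl⟩ := Finset.mem_image.1 (hQ hb)
    obtain ⟨k, hk, rfl⟩ := Finset.mem_image.1 (hQ hc)
    have key : ∀ i j, f i ∈ Q → f j ∈ Q → i < l → j < l → f i ≠ f j →
        j = i + 1 ∨ i = j + 1 ∨ (i = 0 ∧ j + 1 = l) ∨ (j = 0 ∧ i + 1 = l) := by
      intro i j hi hj hil hjl hne
      have hadj := hQc _ hi _ hj hne
      rcases lt_trichotomy i j with hlt | rfl | hlt
      · have := (hole i j hlt hjl).2.1 hadj
        omega
      · exact absurd rfl hne
      · have := (hole j i hlt hil).2.1 hadj.symm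
        omega
    rw [Finset.mem_range] at hi hj hk
    have h1 := key i j ha hb hi hj hab
    have h2 := key i k ha hc hi hk hac
    have h3 := key j k hb hc hj hk hbc
    have hij : i ≠ j := fun e => hab (by rw [e])
    have hik : i ≠ k := fun e => hac (by rw [e])
    have hjk : j ≠ k := fun e => hbc (by rw [e])
    omega
  set I := (Finset.range l).filter (fun i => f i ∈ S) with hI
  have hIcard : S.card ≤ I.card := by
    have : S ⊆ I.image f := by
      intro s hs
      obtain ⟨i, hi, rfl⟩ := Finset.mem_image.1 (hS hs)
      exact Finset.mem_image_of_mem _ (Finset.mem_filter.2 ⟨hi, hs⟩)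
    exact (Finset.card_le_card this).trans Finset.card_image_le
  have h2I : 2 * I.card ≤ l := by
    refine two_mul_card_le_of_not_consecutive (by omega) (Finset.filter_subset _ _) ?_ ?_
    · intro i hi hi'
      simp only [hI, Finset.mem_filter, Finset.mem_range] at hi hi'
      exact hSi _ hi.2 _ hi'.2 ((hole i (i + 1) (by omega) hi'.1).2.2 (Or.inl rfl))
    · rintro ⟨hi, hi'⟩
      simp only [hI, Finset.mem_filter, Finset.mem_range] at hi hi'
      exact hSi _ hi.2 _ hi'.2 ((hole 0 (l - 1) (by omega) hi'.1).2.2 (Or.inr ⟨rfl, by omega⟩))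
  have : Q.card * S.card ≤ 2 * I.card := Nat.mul_le_mul hQ2 hIcard
  obtain ⟨k, rfl⟩ := hodd
  omega

end SimpleGraph

/-! ### Shortest walks, holes and parity. -/

namespace SimpleGraph

variable {V : Type*}

/-- `p 0, …, p a` is a walk of length `a` from `x` to `y`, its inner vertices lying in `S`. -/
def IsWalkThrough (G : SimpleGraph V) (S : Finset V) (a : ℕ) (x y : V) (p : ℕ → V) : Prop :=
  p 0 = x ∧ p a = y ∧ (∀ i < a, G.Adj (p i) (p (i + 1))) ∧ ∀ i, 0 < i → i < a → p i ∈ S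

/-- There is a walk of length `a` from `x` to `y`, its inner vertices lying in `S`. -/
def WalkThrough (G : SimpleGraph V) (S : Finset V) (a : ℕ) (x y : V) : Prop :=
  ∃ p, G.IsWalkThrough S a x y p

/-- `p 0, …, p a` is an induced path. -/
def IsInducedPath (G : SimpleGraph V) (a : ℕ) (p : ℕ → V) : Prop :=
  ∀ i j, i < j → j ≤ a → p i ≠ p j ∧ (G.Adj (p i) (p j) ↔ j = i + 1)

variable {G : SimpleGraph V}

theorem IsWalkThrough.extend {S : Finset V} {a : ℕ} {x y z : V} {p : ℕ → V}
    (h : G.IsWalkThrough S a x y p) (hy : 0 < a → y ∈ S) (hyz : G.Adj y z) :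
    G.IsWalkThrough S (a + 1) x z (Function.update p (a + 1) z) := by
  obtain ⟨h0, ha, hadj, hS⟩ := h
  have hupd : ∀ i ≤ a, Function.update p (a + 1) z i = p i := fun i hi =>
    Function.update_of_ne (by omega) _ _
  refine ⟨by rw [hupd 0 (by omega), h0], Function.update_self .., ?_, ?_⟩
  · intro i hi
    rw [hupd i (by omega)]
    rcases Nat.lt_or_ge i a with hlt | hge
    · rw [hupd (i + 1) (by omega)]
      exact hadj i hlt
    · obtain rfl : i = a := by omega
      rw [Function.update_self, ha]
      exact hyz
  · intro i hi hia
    rw [hupd i (by omega)]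
    rcases Nat.lt_or_ge i a with hlt | hge
    · exact hS i hi hlt
    · obtain rfl : i = a := by omega
      rw [ha]
      exact hy hi

theorem IsWalkThrough.prefix {S : Finset V} {a : ℕ} {x y : V} {p : ℕ → V}
    (h : G.IsWalkThrough S a x y p) {i : ℕ} (hi : i ≤ a) : G.IsWalkThrough S i x (p i) p :=
  ⟨h.1, rfl, fun j hj => h.2.2.1 j (by omega), fun j hj hji => h.2.2.2 j hj (by omega)⟩

theorem IsWalkThrough.isInducedPath {S : Finset V} {a : ℕ} {x y : V} {p : ℕ → V}
    (h : G.IsWalkThrough S a x y p) (hmin : ∀ a' < a, ¬ G.WalkThrough S a' x y) :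
    G.IsInducedPath a p := by
  obtain ⟨h0, ha, hadj, hS⟩ := h
  -- Skipping the d vertices after `p i` would give a shorter walk. A repeated vertex or a chord
  -- permits such a cut; `hend` covers a cut that reaches the end of the walk.
  have short : ∀ i d, 0 < d → i + d ≤ a →
      (i + d < a → G.Adj (p i) (p (i + d + 1))) → (i + d = a → p i = p a) → False := by
    intro i d hd hid hstep hend
    refine hmin (a - d) (by omega) ⟨fun k => if k ≤ i then p k else p (k + d), ?_, ?_, ?_, ?_⟩
    · simpa using h0
    · dsimp only
      split_ifs with hle
      · have : i + d = a := by omega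
        rw [← ha, ← hend this]
        congr 1
        omega
      · rw [← ha]
        congr 1
        omega
    · intro k hk
      dsimp only
      split_ifs with h1 h2 h2
      · exact hadj k (by omega)
      · obtain rfl : k = i := by omega
        have := hstep (by omega)
        rwa [show k + 1 + d = k + d + 1 by omega]
      · omega
      · rw [show k + 1 + d = k + d + 1 by omega]
        exact hadj _ (by omega)
    · intro k hk hka
      dsimp only
      split_ifs
      · exact hS k hk (by omega)
      · exact hS _ (by omega) (by omega)
  intro i j hij hja
  refine ⟨fun he => ?_, fun hadj' => ?_, ?_⟩
  · refine short i (j - i) (by omega) (by omega) (fun hlt => ?_) (fun he' => ?_)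
    · rw [he, show i + (j - i) + 1 = j + 1 by omega]
      exact hadj j (by omega)
    · rw [he]
      congr 1
      omega
  · by_contra hne
    refine short i (j - i - 1) (by omega) (by omega) (fun hlt => ?_) (fun he' => ?_)
    · rwa [show i + (j - i - 1) + 1 = j by omega]
    · omega
  · rintro rfl
    exact hadj i (by omega)

theorem WalkThrough.exists_inducedPath {S : Finset V} {a : ℕ} {x y : V}
    (h : G.WalkThrough S a x y) :
    ∃ b p, G.IsWalkThrough S b x y p ∧ G.IsInducedPath b p := by
  classical
  have hex : ∃ a, G.WalkThrough S a x y := ⟨a, h⟩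
  obtain ⟨p, hp⟩ := Nat.find_spec hex
  exact ⟨Nat.find hex, p, hp, hp.isInducedPath fun a' ha' => Nat.find_min hex ha'⟩

/-- Two induced paths with the same ends and otherwise disjoint and anticomplete form a hole. -/
theorem IsInducedPath.isHole {a b : ℕ} {p r : ℕ → V} (hp : G.IsInducedPath a p)
    (hr : G.IsInducedPath b r) (ha : 2 ≤ a) (hb : 2 ≤ b) (h0 : p 0 = r b) (h1 : p a = r 0)
    (hanti : ∀ i j, 0 < i → i < a → 0 < j → j < b → p i ≠ r j ∧ ¬ G.Adj (p i) (r j)) :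
    G.IsHole (a + b) (fun k => if k < a then p k else r (k - a)) := by
  intro i j hij hj
  dsimp only
  split_ifs with hi hja hja
  · obtain ⟨h2, h3⟩ := hp i j hij hja.le
    refine ⟨h2, h3.trans ?_⟩
    omega
  · rcases Nat.eq_zero_or_pos i with rfl | hi0
    · rw [h0]
      obtain ⟨h2, h3⟩ := hr (j - a) b (by omega) le_rfl
      refine ⟨h2.symm, (G.adj_comm _ _).trans (h3.trans ?_)⟩
      omega
    · rcases Nat.eq_or_lt_of_le (not_lt.1 hja) with rfl | hlt
      · rw [Nat.sub_self, ← h1]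
        obtain ⟨h2, h3⟩ := hp i a hi le_rfl
        refine ⟨h2, h3.trans ?_⟩
        omega
      · obtain ⟨h2, h3⟩ := hanti i (j - a) hi0 hi (by omega) (by omega)
        refine ⟨h2, iff_of_false h3 ?_⟩
        omega
  · omega
  · obtain ⟨h2, h3⟩ := hr (i - a) (j - a) (by omega) (by omega)
    refine ⟨h2, h3.trans ?_⟩
    omega

theorem OddHoleFree.even_add (h : G.OddHoleFree) {a b : ℕ} {p r : ℕ → V}
    (hp : G.IsInducedPath a p) (hr : G.IsInducedPath b r) (ha : 2 ≤ a) (hb : 2 ≤ b)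
    (h0 : p 0 = r b) (h1 : p a = r 0)
    (hanti : ∀ i j, 0 < i → i < a → 0 < j → j < b → p i ≠ r j ∧ ¬ G.Adj (p i) (r j)) :
    Even (a + b) := by
  by_contra hodd
  rw [Nat.not_even_iff_odd] at hodd
  have h5 : 5 ≤ a + b := by
    obtain ⟨k, hk⟩ := hodd
    omega
  exact h _ _ h5 hodd (hp.isHole hr ha hb h0 h1 hanti)

/-- `Z` and `T` are anticomplete, and `y`, `y'` are adjacent vertices that are reached from `x`
through `Z` in the same number `l` of steps and not faster. If moreover `y'` is joined to `x`
through `T`, and `y` has no neighbour in `T`, then a neighbour `q` of `y` that is reached in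
`l - 1` steps is also a neighbour of `y'`. -/
theorem OddHoleFree.adj_of_shortest (h : G.OddHoleFree) {Z T : Finset V} {l : ℕ} {x y y' q : V}
    (hZT : ∀ z ∈ Z, ∀ t ∈ T, z ≠ t ∧ ¬ G.Adj z t) (hyT : ∀ t ∈ T, y ≠ t ∧ ¬ G.Adj y t)
    (hl : 2 ≤ l) (hxy' : ¬ G.Adj x y') (hxne : x ≠ y') (hy'Z : y' ∉ Z)
    (hmin : ∀ a < l, ¬ G.WalkThrough Z a x y) (hmin' : ∀ a < l, ¬ G.WalkThrough Z a x y')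
    (hl' : G.WalkThrough Z l x y') (hq : G.WalkThrough Z (l - 1) x q) (hqZ : q ∈ Z)
    (hqy : G.Adj q y) (hyy' : G.Adj y y') (hT : ∃ b, G.WalkThrough T b y' x) :
    G.Adj q y' := by
  by_contra hqy'
  obtain ⟨b, hb⟩ := hT
  obtain ⟨b, r, hrw, hr⟩ := hb.exists_inducedPath
  have hb2 : 2 ≤ b := by
    rcases Nat.lt_or_ge b 2 with hlt | hge
    · interval_cases b
      · exact absurd (hrw.1.symm.trans hrw.2.1).symm hxne
      · have := hrw.2.2.1 0 (by omega)
        rw [hrw.1, hrw.2.1] at this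
        exact absurd this.symm hxy'
    · exact hge
  obtain ⟨p', hp'w⟩ := hl'
  have hp' := hp'w.isInducedPath hmin'
  have e1 := h.even_add hp' hr hl hb2 (by rw [hp'w.1, hrw.2.1]) (by rw [hp'w.2.1, hrw.1])
    (fun i j hi hi' hj hj' => hZT _ (hp'w.2.2.2 i hi hi') _ (hrw.2.2.2 j hj hj'))
  obtain ⟨s, hs⟩ := hq
  have hp1 := hs.extend (fun _ => hqZ) hqy
  rw [show l - 1 + 1 = l by omega] at hp1
  have hpq : Function.update s l y (l - 1) = q := by
    rw [Function.update_of_ne (by omega), hs.2.1]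
  generalize Function.update s l y = p at hp1 hpq
  have hp := hp1.isInducedPath hmin
  -- Appending y' to the shortest path to y gives an induced path of length l + 1, one more than the
  -- path `p'` to y'.
  set P := Function.update p (l + 1) y' with hP
  have hPp : ∀ i ≤ l, P i = p i := fun i hi => Function.update_of_ne (by omega) _ _
  have hPl : P (l + 1) = y' := Function.update_self ..
  have hPind : G.IsInducedPath (l + 1) P := by
    intro i j hij hj
    rcases Nat.lt_or_ge l j with hlj | hjl
    · obtain rfl : j = l + 1 := by omega
      rw [hPl, hPp i (by omega)]
      rcases Nat.lt_or_ge i l with hil | hil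
      · rcases Nat.eq_zero_or_pos i with rfl | hi0
        · rw [hp1.1]
          exact ⟨hxne, iff_of_false hxy' (by omega)⟩
        · have hiZ := hp1.2.2.2 i hi0 hil
          refine ⟨fun he => hy'Z (he ▸ hiZ), iff_of_false (fun hadj => ?_) (by omega)⟩
          -- A neighbour of y' before q would reach y' in fewer than l steps; q itself is excluded
          -- by assumption.
          rcases Nat.lt_or_ge (i + 1) l with hlt | hge
          · exact hmin' (i + 1) hlt
              ⟨_, (hp1.prefix hil.le).extend (fun _ => hiZ) hadj⟩
          · obtain rfl : i = l - 1 := by omega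
            exact hqy' (hpq ▸ hadj)
      · obtain rfl : i = l := by omega
        rw [hp1.2.1]
        exact ⟨hyy'.ne, iff_of_true hyy' rfl⟩
    · rw [hPp i (by omega), hPp j hjl]
      exact hp i j hij hjl
  have e2 := h.even_add hPind hr (by omega) hb2 (by rw [hPp 0 (by omega), hp1.1, hrw.2.1])
    (by rw [hPl, hrw.1]) (by
      intro i j hi hi' hj hj'
      rw [hPp i (by omega)]
      rcases Nat.lt_or_ge i l with hil | hil
      · exact hZT _ (hp1.2.2.2 i hi hil) _ (hrw.2.2.2 j hj hj')
      · obtain rfl : i = l := by omega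
        rw [hp1.2.1]
        exact hyT _ (hrw.2.2.2 j hj hj'))
  rw [Nat.even_iff] at e1 e2
  omega

end SimpleGraph

/-! ### Expansion and growing connected sets. -/

namespace SimpleGraph

open Classical in
/-- The vertices with a neighbour in `S`. -/
noncomputable def nbhd {V : Type*} [Fintype V] (G : SimpleGraph V) (S : Finset V) : Finset V :=
  Finset.univ.filter fun v => ∃ u ∈ S, G.Adj u v

open Classical in
/-- The vertices in `B i` that are reached from `S` by a walk with successive vertices in
`B 1, …, B i`. -/
noncomputable def reach {V : Type*} [Fintype V] (G : SimpleGraph V) (B : ℕ → Finset V) :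
    ℕ → Finset V → Finset V
  | 0, S => S
  | i + 1, S => G.nbhd (reach G B i S) ∩ B (i + 1)

/-- Any two disjoint sets of at least `m` vertices are joined by an edge. -/
def EdgeBetween {V : Type*} (G : SimpleGraph V) (m : ℕ) : Prop :=
  ∀ A B : Finset V, Disjoint A B → m ≤ A.card → m ≤ B.card → ∃ a ∈ A, ∃ b ∈ B, G.Adj a b

/-- Any two vertices of `T` are joined by a path in `T`. -/
def ConnectedOn {V : Type*} (G : SimpleGraph V) (T : Finset V) : Prop :=
  ∀ u ∈ T, ∀ v ∈ T, Relation.ReflTransGen (fun a b => G.Adj a b ∧ b ∈ T) u v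

/-- Pigeonhole: cut S into D pieces of size at most a; as f preserves unions, the image of some
piece has at least m elements. -/
theorem exists_subset_card_le_of_union {V : Type*} [DecidableEq V] {f : Finset V → Finset V}
    (hf : ∀ S S', f (S ∪ S') = f S ∪ f S') {a m D : ℕ} (hD : 1 ≤ D) {S : Finset V}
    (hS : S.card ≤ D * a) (hfS : D * m ≤ (f S).card) :
    ∃ S' ⊆ S, S'.card ≤ a ∧ m ≤ (f S').card := by
  induction D, hD using Nat.le_induction generalizing S with
  | base => exact ⟨S, Finset.Subset.rfl, by simpa using hS, by simpa using hfS⟩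
  | succ D hD ih =>
    obtain ⟨S₁, hS₁, hcard⟩ := Finset.exists_subset_card_eq (min_le_right a S.card)
    by_cases hm : m ≤ (f S₁).card
    · exact ⟨S₁, hS₁, hcard ▸ min_le_left _ _, hm⟩
    have h1 : (S \ S₁).card ≤ D * a := by
      rw [Finset.card_sdiff_of_subset hS₁, hcard]
      rw [Nat.add_mul, one_mul] at hS
      omega
    have h2 : D * m ≤ (f (S \ S₁)).card := by
      have h3 : (f S).card ≤ (f S₁).card + (f (S \ S₁)).card := by
        rw [← Finset.union_sdiff_of_subset hS₁, hf, Finset.union_sdiff_of_subset hS₁]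
        exact Finset.card_union_le _ _
      rw [Nat.add_mul, one_mul] at hfS
      omega
    obtain ⟨S', hS', h4, h5⟩ := ih h1 h2
    exact ⟨S', hS'.trans Finset.sdiff_subset, h4, h5⟩

theorem connectedOn_singleton {V : Type*} {G : SimpleGraph V} (v : V) : G.ConnectedOn {v} := by
  intro u hu w hw
  rw [Finset.mem_singleton.1 hu, Finset.mem_singleton.1 hw]

variable {V : Type*} [Fintype V] {G : SimpleGraph V}

theorem mem_nbhd {S : Finset V} {v : V} : v ∈ G.nbhd S ↔ ∃ u ∈ S, G.Adj u v := by
  classical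
  simp [nbhd]

theorem nbhd_mono {S S' : Finset V} (h : S ⊆ S') : G.nbhd S ⊆ G.nbhd S' := by
  intro v hv
  obtain ⟨u, hu, huv⟩ := mem_nbhd.1 hv
  exact mem_nbhd.2 ⟨u, h hu, huv⟩

theorem EdgeBetween.card_sdiff_nbhd_lt [DecidableEq V] {m : ℕ} (h : G.EdgeBetween m)
    {S : Finset V} (hS : m ≤ S.card) (B : Finset V) (hSB : Disjoint S B) :
    (B \ G.nbhd S).card < m := by
  by_contra hcon
  obtain ⟨a, ha, b, hb, hab⟩ := h S (B \ G.nbhd S)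
    (hSB.mono_right Finset.sdiff_subset) hS (not_lt.1 hcon)
  exact (Finset.mem_sdiff.1 hb).2 (mem_nbhd.2 ⟨a, ha, hab⟩)

/-- The sets may overlap, whence 2m instead of m: m vertices are lost in a chosen subset of S, and
fewer than m of the others are missed by its neighbourhood. -/
theorem EdgeBetween.card_lt_card_nbhd_inter [DecidableEq V] {m : ℕ} (h : G.EdgeBetween m)
    {S : Finset V} (hS : m ≤ S.card) (B : Finset V) :
    B.card < (G.nbhd S ∩ B).card + 2 * m := by
  obtain ⟨S', hS', hcard⟩ := Finset.exists_subset_card_eq hS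
  have h1 := h.card_sdiff_nbhd_lt hcard.ge (B \ S') Finset.disjoint_sdiff
  have h2 : B ⊆ (G.nbhd S ∩ B) ∪ (S' ∪ ((B \ S') \ G.nbhd S')) := by
    intro v hv
    have := @nbhd_mono V _ G _ _ hS' v
    simp only [Finset.mem_union, Finset.mem_inter, Finset.mem_sdiff]
    tauto
  have h3 := Finset.card_le_card h2
  have h4 := Finset.card_union_le (G.nbhd S ∩ B) (S' ∪ ((B \ S') \ G.nbhd S'))
  have h5 := Finset.card_union_le S' ((B \ S') \ G.nbhd S')
  omega

theorem nbhd_union [DecidableEq V] (S S' : Finset V) :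
    G.nbhd (S ∪ S') = G.nbhd S ∪ G.nbhd S' := by
  ext v
  simp only [mem_nbhd, Finset.mem_union]
  constructor
  · rintro ⟨u, hu | hu, huv⟩
    exacts [Or.inl ⟨u, hu, huv⟩, Or.inr ⟨u, hu, huv⟩]
  · rintro (⟨u, hu, huv⟩ | ⟨u, hu, huv⟩)
    exacts [⟨u, Or.inl hu, huv⟩, ⟨u, Or.inr hu, huv⟩]

theorem mem_reach_succ {B : ℕ → Finset V} {i : ℕ} {S : Finset V} {v : V} :
    v ∈ G.reach B (i + 1) S ↔ (∃ u ∈ G.reach B i S, G.Adj u v) ∧ v ∈ B (i + 1) := by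
  classical
  rw [reach, Finset.mem_inter, mem_nbhd]

theorem reach_union [DecidableEq V] (B : ℕ → Finset V) (i : ℕ) (S S' : Finset V) :
    G.reach B i (S ∪ S') = G.reach B i S ∪ G.reach B i S' := by
  induction i with
  | zero => rfl
  | succ i ih =>
    ext v
    simp only [mem_reach_succ, ih, Finset.mem_union]
    constructor
    · rintro ⟨⟨u, hu | hu, huv⟩, hv⟩
      exacts [Or.inl ⟨⟨u, hu, huv⟩, hv⟩, Or.inr ⟨⟨u, hu, huv⟩, hv⟩]
    · rintro (⟨⟨u, hu, huv⟩, hv⟩ | ⟨⟨u, hu, huv⟩, hv⟩)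
      exacts [⟨⟨u, Or.inl hu, huv⟩, hv⟩, ⟨⟨u, Or.inr hu, huv⟩, hv⟩]

/-- Expansion from a single vertex. -/
theorem EdgeBetween.exists_reach {m D K : ℕ} (h : G.EdgeBetween m) (hm : 1 ≤ m) (hD : 1 ≤ D)
    (hmD : m ≤ D ^ K) {B : ℕ → Finset V} (h0 : m ≤ (B 0).card)
    (hB : ∀ i, 1 ≤ i → i ≤ K → D * m + 2 * m ≤ (B i).card) :
    ∃ v ∈ B 0, m ≤ (G.reach B K {v}).card := by
  classical
  -- Each further step reaches at least D * m vertices, so the starting set can be cut by a factor D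
  -- while still reaching m. After K steps at most one starting vertex is left.
  have key : ∀ i ≤ K, ∃ S ⊆ B 0, S.card ≤ D ^ (K - i) ∧ m ≤ (G.reach B i S).card := by
    intro i
    induction i with
    | zero =>
      intro _
      obtain ⟨S, hS, hcard⟩ := Finset.exists_subset_card_eq h0
      exact ⟨S, hS, by simpa [hcard] using hmD, hcard.ge⟩
    | succ i ih =>
      intro hi
      obtain ⟨S, hS, hcard, hreach⟩ := ih (by omega)
      have h1 := h.card_lt_card_nbhd_inter hreach (B (i + 1))
      have h2 := hB (i + 1) (by omega) hi
      obtain ⟨S', hS', h3, h4⟩ := exists_subset_card_le_of_union (f := G.reach B (i + 1))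
        (reach_union B (i + 1)) (a := D ^ (K - (i + 1))) (m := m) hD (S := S)
        (by rwa [← pow_succ', show K - (i + 1) + 1 = K - i by omega])
        (by
          have : G.reach B (i + 1) S = G.nbhd (G.reach B i S) ∩ B (i + 1) := by
            ext v
            rw [mem_reach_succ, Finset.mem_inter, mem_nbhd]
          rw [this]
          omega)
      exact ⟨S', hS'.trans hS, h3, h4⟩
  obtain ⟨S, hS, hcard, hreach⟩ := key K le_rfl
  rw [Nat.sub_self, pow_zero] at hcard
  have hempty : ∀ i, G.reach B i ∅ = ∅ := by
    intro i
    induction i with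
    | zero => rfl
    | succ i ih =>
      ext v
      simp [mem_reach_succ, ih]
  rcases S.eq_empty_or_nonempty with rfl | ⟨v, hv⟩
  · rw [hempty] at hreach
    simp at hreach
    omega
  · obtain rfl : S = {v} :=
      Finset.eq_singleton_iff_unique_mem.2 ⟨hv, fun w hw => Finset.card_le_one.1 hcard w hw v hv⟩
    exact ⟨v, hS hv, hreach⟩

theorem walkThrough_of_mem_reach {B : ℕ → Finset V} {Z : Finset V} {x : V}
    (hB : ∀ i, 1 ≤ i → B i = Z) (i : ℕ) :
    ∀ v ∈ G.reach B i {x}, G.WalkThrough Z i x v ∧ (0 < i → v ∈ Z) := by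
  induction i with
  | zero =>
    intro v hv
    obtain rfl := Finset.mem_singleton.1 hv
    exact ⟨⟨fun _ => v, rfl, rfl, fun i hi => by omega, fun i _ hi => by omega⟩, by simp⟩
  | succ i ih =>
    intro v hv
    obtain ⟨⟨u, hu, huv⟩, hvB⟩ := mem_reach_succ.1 hv
    obtain ⟨⟨p, hp⟩, huZ⟩ := ih u hu
    rw [hB (i + 1) (by omega)] at hvB
    exact ⟨⟨_, hp.extend huZ huv⟩, fun _ => hvB⟩

theorem ConnectedOn.insert [DecidableEq V] {T : Finset V} (hT : G.ConnectedOn T) {w : V}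
    (hw : w ∈ G.nbhd T) : G.ConnectedOn (insert w T) := by
  obtain ⟨t, ht, htw⟩ := mem_nbhd.1 hw
  have hmono : ∀ {u v}, Relation.ReflTransGen (fun a b => G.Adj a b ∧ b ∈ T) u v →
      Relation.ReflTransGen (fun a b => G.Adj a b ∧ b ∈ Insert.insert w T) u v :=
    fun h => Relation.ReflTransGen.mono (fun a b (hab : G.Adj a b ∧ b ∈ T) =>
      (⟨hab.1, Finset.mem_insert_of_mem hab.2⟩ : G.Adj a b ∧ b ∈ Insert.insert w T)) _ _ h
  intro u hu v hv
  rcases Finset.mem_insert.1 hu with hu' | hu' <;> rcases Finset.mem_insert.1 hv with hv' | hv'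
  · rw [hu', hv']
  · rw [hu']
    exact Relation.ReflTransGen.head ⟨htw.symm, Finset.mem_insert_of_mem ht⟩
      (hmono (hT t ht v hv'))
  · rw [hv']
    exact (hmono (hT u hu' t ht)).tail ⟨htw, Finset.mem_insert_self _ _⟩
  · exact hmono (hT u hu' v hv')

theorem ConnectedOn.exists_walkThrough {T : Finset V} (hT : G.ConnectedOn T) {x y : V}
    (hx : x ∈ G.nbhd T) (hy : y ∈ G.nbhd T) : ∃ b, G.WalkThrough T b y x := by
  obtain ⟨s, hs, hsx⟩ := mem_nbhd.1 hx
  obtain ⟨t, ht, hty⟩ := mem_nbhd.1 hy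
  have key : ∃ b, G.WalkThrough T b y s := by
    have h0 : G.IsWalkThrough T 0 y y (fun _ => y) :=
      ⟨rfl, rfl, fun i hi => by omega, fun i _ hi => by omega⟩
    have h1 : ∃ b, G.WalkThrough T b y t ∧ t ∈ T :=
      ⟨1, ⟨_, h0.extend (fun h => absurd h (by simp)) hty.symm⟩, ht⟩
    have : ∀ s, Relation.ReflTransGen (fun a b => G.Adj a b ∧ b ∈ T) t s →
        ∃ b, G.WalkThrough T b y s ∧ s ∈ T := by
      intro s hs
      induction hs with
      | refl => exact h1
      | tail _ hbc ih =>
        obtain ⟨b, ⟨p, hp⟩, hbT⟩ := ih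
        exact ⟨b + 1, ⟨_, hp.extend (fun _ => hbT) hbc.1⟩, hbc.2⟩
    obtain ⟨b, hb, -⟩ := this s (hT t ht s hs)
    exact ⟨b, hb⟩
  obtain ⟨b, p, hp⟩ := key
  exact ⟨b + 1, _, hp.extend (fun _ => hs) hsx⟩

/-- A connected set grows inside a large component, one vertex at a time, until its closed
neighbourhood has a prescribed size, up to the maximum degree. -/
theorem EdgeBetween.exists_connectedOn_superset [DecidableEq V] {m Δ θ : ℕ}
    (h : G.EdgeBetween m) (hΔ : ∀ v, (G.nbhd {v}).card + 1 ≤ Δ) (hθ : θ + m ≤ Fintype.card V)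
    {T : Finset V} (hT : G.ConnectedOn T)
    (hlarge : ∀ S : Finset V, T ⊆ S → G.nbhd S ⊆ S → m ≤ S.card)
    (hTθ : (T ∪ G.nbhd T).card < θ) :
    ∃ T', T ⊆ T' ∧ G.ConnectedOn T' ∧ θ ≤ (T' ∪ G.nbhd T').card ∧
      (T' ∪ G.nbhd T').card ≤ θ + Δ := by
  classical
  set F := (Finset.univ : Finset (Finset V)).filter
    (fun S => T ⊆ S ∧ G.ConnectedOn S ∧ (S ∪ G.nbhd S).card < θ) with hF
  have hTF : T ∈ F := Finset.mem_filter.2 ⟨Finset.mem_univ _, Finset.Subset.rfl, hT, hTθ⟩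
  -- A largest connected set below the threshold is not closed under neighbours, so one more vertex
  -- can be added. This crosses the threshold by maximality and overshoots by at most one degree.
  obtain ⟨S, hSF, hmax⟩ := F.exists_max_image Finset.card ⟨T, hTF⟩
  obtain ⟨-, hTS, hS, hSθ⟩ := Finset.mem_filter.1 hSF
  have hnot : ¬ G.nbhd S ⊆ S := by
    intro hsub
    have h1 := hlarge S hTS hsub
    have h2 := h.card_sdiff_nbhd_lt h1 (Finset.univ \ S) Finset.disjoint_sdiff
    have h3 : (Finset.univ \ S) \ G.nbhd S = Finset.univ \ S := by
      ext v
      have := @hsub v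
      simp only [Finset.mem_sdiff]
      tauto
    rw [h3, Finset.card_sdiff_of_subset (Finset.subset_univ _), Finset.card_univ] at h2
    have h4 : S.card ≤ (S ∪ G.nbhd S).card := Finset.card_le_card Finset.subset_union_left
    omega
  obtain ⟨w, hw, hwS⟩ := Finset.not_subset.1 hnot
  have hcon := hS.insert hw
  refine ⟨insert w S, hTS.trans (Finset.subset_insert _ _), hcon, ?_, ?_⟩
  · by_contra hlt
    have := hmax (insert w S) (Finset.mem_filter.2 ⟨Finset.mem_univ _,
      hTS.trans (Finset.subset_insert _ _), hcon, not_le.1 hlt⟩)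
    rw [Finset.card_insert_of_notMem hwS] at this
    omega
  · have hsub : insert w S ∪ G.nbhd (insert w S) ⊆ (S ∪ G.nbhd S) ∪ G.nbhd {w} := by
      rw [Finset.insert_eq, nbhd_union]
      intro v hv
      simp only [Finset.mem_union, Finset.mem_singleton] at hv ⊢
      rcases hv with (rfl | hv) | hv | hv <;> tauto
    have h1 := Finset.card_le_card hsub
    have h2 := Finset.card_union_le (S ∪ G.nbhd S) (G.nbhd {w})
    have h3 := hΔ w
    omega

/-- An increasing sequence of connected sets with closed neighbourhoods of prescribed sizes. -/
theorem EdgeBetween.exists_connectedOn_chain [DecidableEq V] {m D K Δ β : ℕ}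
    (h : G.EdgeBetween m) (hm : 1 ≤ m) (hD : 1 ≤ D) (hmD : m ≤ D ^ K)
    (hΔ : ∀ v, (G.nbhd {v}).card + 1 ≤ Δ) (hβ : Δ < β) (k : ℕ)
    (hn : (2 * k + 1) * β + m ≤ Fintype.card V) (hn' : D * m + 2 * m ≤ Fintype.card V) :
    ∃ T : ℕ → Finset V, (∀ i < k, T i ⊆ T (i + 1)) ∧ ∀ i ≤ k, G.ConnectedOn (T i) ∧
      (2 * i + 1) * β ≤ (T i ∪ G.nbhd (T i)).card ∧
      (T i ∪ G.nbhd (T i)).card ≤ (2 * i + 1) * β + Δ := by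
  obtain ⟨v, -, hv⟩ := h.exists_reach hm hD hmD (B := fun _ => Finset.univ)
    (by rw [Finset.card_univ]; omega) (fun i _ _ => by rw [Finset.card_univ]; omega)
  -- The component of v is large, so no growing set containing v stops early.
  have hlarge : ∀ S : Finset V, v ∈ S → G.nbhd S ⊆ S → m ≤ S.card := by
    intro S hvS hS
    refine hv.trans (Finset.card_le_card ?_)
    have : ∀ i, G.reach (fun _ => Finset.univ) i {v} ⊆ S := by
      intro i
      induction i with
      | zero => exact Finset.singleton_subset_iff.2 hvS
      | succ i ih =>
        intro w hw
        obtain ⟨⟨u, hu, huw⟩, -⟩ := mem_reach_succ.1 hw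
        exact hS (mem_nbhd.2 ⟨u, ih hu, huw⟩)
    exact this K
  suffices hs : ∀ l ≤ k, ∃ T : ℕ → Finset V, (∀ i < l, T i ⊆ T (i + 1)) ∧
      ∀ i ≤ l, v ∈ T i ∧ G.ConnectedOn (T i) ∧
      (2 * i + 1) * β ≤ (T i ∪ G.nbhd (T i)).card ∧
      (T i ∪ G.nbhd (T i)).card ≤ (2 * i + 1) * β + Δ by
    obtain ⟨T, h1, h2⟩ := hs k le_rfl
    exact ⟨T, h1, fun i hi => (h2 i hi).2⟩
  intro l
  induction l with
  | zero =>
    intro _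
    have hle : (2 * 0 + 1) * β ≤ (2 * k + 1) * β := Nat.mul_le_mul_right _ (by omega)
    obtain ⟨T, h1, h2, h3⟩ := h.exists_connectedOn_superset hΔ (θ := (2 * 0 + 1) * β) (by omega)
      (connectedOn_singleton v)
      (fun S hS => hlarge S (Finset.singleton_subset_iff.1 hS)) (by
        have h1 := Finset.card_union_le {v} (G.nbhd {v})
        have h2 := hΔ v
        rw [Finset.card_singleton] at h1
        omega)
    refine ⟨fun _ => T, fun i hi => by omega, fun i hi => ?_⟩
    obtain rfl : i = 0 := by omega
    exact ⟨h1 (Finset.mem_singleton_self v), h2, h3⟩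
  | succ l ih =>
    intro hl
    obtain ⟨T, hTmono, hT⟩ := ih (by omega)
    obtain ⟨hvT, hTc, hT1, hT2⟩ := hT l le_rfl
    have hle : (2 * (l + 1) + 1) * β ≤ (2 * k + 1) * β := Nat.mul_le_mul_right _ (by omega)
    have hstep : (2 * (l + 1) + 1) * β = (2 * l + 1) * β + 2 * β := by ring
    obtain ⟨T', h1, h2, h3⟩ := h.exists_connectedOn_superset hΔ (θ := (2 * (l + 1) + 1) * β)
      (by omega) hTc (fun S hS => hlarge S (hS hvT)) (by omega)
    have hupd : ∀ i ≤ l, Function.update T (l + 1) T' i = T i := fun i hi =>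
      Function.update_of_ne (by omega) _ _
    refine ⟨Function.update T (l + 1) T', ?_, ?_⟩
    · intro i hi
      rcases Nat.lt_or_ge i l with hil | hil
      · rw [hupd i hil.le, hupd (i + 1) hil]
        exact hTmono i hil
      · obtain rfl : i = l := by omega
        rw [hupd i le_rfl, Function.update_self]
        exact h1
    · intro i hi
      rcases Nat.lt_or_ge l i with hil | hil
      · obtain rfl : i = l + 1 := by omega
        rw [Function.update_self]
        exact ⟨h1 hvT, h2, h3⟩
      · rw [hupd i hil]
        exact hT i hil

end SimpleGraph

/-! ### Sparse graphs without odd holes. -/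

namespace SimpleGraph

variable {V : Type*} [Fintype V] {G : SimpleGraph V}

theorem chain_subset {V : Type*} {T : ℕ → Finset V} {k : ℕ} (h : ∀ i < k, T i ⊆ T (i + 1)) {i j : ℕ}
    (hij : i ≤ j) (hj : j ≤ k) : T i ⊆ T j := by
  induction j, hij using Nat.le_induction with
  | base => exact Finset.Subset.rfl
  | succ j hij ih => exact (ih (by omega)).trans (h j hj)

/-- In a graph of small maximum degree without odd holes there are two large anticomplete sets. -/
theorem OddHoleFree.not_edgeBetween (hG : G.OddHoleFree) {m D K Δ β k : ℕ} (hm : 1 ≤ m)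
    (hD : 1 ≤ D) (hK : 1 ≤ K) (hmD : m ≤ D ^ K) (hΔ : ∀ v, (G.nbhd {v}).card + 1 ≤ Δ)
    (hk : k = K * (K + 1) + 1)
    (hβ : K * (D * m + 2 * m + Δ) + 3 * m + Δ ≤ β)
    (hn : (2 * k + 3) * β ≤ Fintype.card V) : ¬ G.EdgeBetween m := by
  classical
  intro h
  set μ := D * m + 2 * m + Δ with hμ
  have hμK : μ ≤ K * μ := Nat.le_mul_of_pos_left _ hK
  have hβμ : μ + 3 * m + Δ ≤ β := by omega
  have hn2 : (2 * k + 3) * β = (2 * k + 1) * β + 2 * β := by ring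
  obtain ⟨T, hTmono, hT⟩ := h.exists_connectedOn_chain hm hD hmD hΔ (β := β) (by omega) k
    (by omega) (by omega)
  set N : ℕ → Finset V := fun i => T i ∪ G.nbhd (T i) with hN
  have hNmono : ∀ {i j}, i ≤ j → j ≤ k → N i ⊆ N j := fun hij hj =>
    Finset.union_subset_union (chain_subset hTmono hij hj)
      (nbhd_mono (chain_subset hTmono hij hj))
  -- Otherwise the neighbourhood of `T k` would miss fewer than 2m vertices, contrary to its
  -- prescribed size.
  have hTk : (T k).card < m := by
    by_contra hcon
    have h1 := h.card_lt_card_nbhd_inter (not_lt.1 hcon) Finset.univ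
    rw [Finset.inter_univ, Finset.card_univ] at h1
    have h2 := (hT k le_rfl).2.2
    have h3 : (G.nbhd (T k)).card ≤ (T k ∪ G.nbhd (T k)).card :=
      Finset.card_le_card Finset.subset_union_right
    omega
  set Z := Finset.univ \ N k with hZ
  have hZcard : D * m + 2 * m ≤ Z.card := by
    rw [hZ, Finset.card_sdiff_of_subset (Finset.subset_univ _), Finset.card_univ]
    have : (N k).card ≤ (2 * k + 1) * β + Δ := (hT k le_rfl).2.2
    omega
  have hZN : ∀ z ∈ Z, z ∉ N k := fun z hz => (Finset.mem_sdiff.1 hz).2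
  set F := N 0 \ T k with hF
  have hFcard : m ≤ F.card := by
    have h1 : (2 * 0 + 1) * β ≤ (N 0).card := (hT 0 (by omega)).2.1
    have h2 := Finset.le_card_sdiff (T k) (N 0)
    rw [hF]
    omega
  -- a vertex `x` attached to `T 0` that reaches many vertices of `Z`
  obtain ⟨x, hxF, hx⟩ := h.exists_reach hm hD hmD (B := fun i => if i = 0 then F else Z)
    (by simpa using hFcard) (by
      intro i hi _
      rw [if_neg (by omega)]
      exact hZcard)
  rw [if_pos rfl] at hxF
  obtain ⟨hxN, hxT⟩ := Finset.mem_sdiff.1 hxF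
  have hxnb : x ∈ G.nbhd (T 0) := by
    rcases Finset.mem_union.1 hxN with h1 | h1
    · exact absurd (chain_subset hTmono (Nat.zero_le k) le_rfl h1) hxT
    · exact h1
  set R := G.reach (fun i => if i = 0 then F else Z) K {x} with hR
  have hRw : ∀ v ∈ R, G.WalkThrough Z K x v ∧ v ∈ Z := by
    intro v hv
    obtain ⟨h1, h2⟩ := walkThrough_of_mem_reach (Z := Z) (fun i hi => if_neg (by omega)) K v hv
    exact ⟨h1, h2 (by omega)⟩
  -- the blocks
  set Y : ℕ → Finset V := fun j => ((N j \ N (j - 1)) \ T k) \ G.nbhd {x} with hY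
  have hYcard : ∀ j, 1 ≤ j → j ≤ k → K * μ + 2 * m ≤ (Y j).card := by
    intro j hj hjk
    have h1 : (2 * j + 1) * β ≤ (N j).card := (hT j hjk).2.1
    have h2 : (N (j - 1)).card ≤ (2 * (j - 1) + 1) * β + Δ := (hT (j - 1) (by omega)).2.2
    have h3 := Finset.le_card_sdiff (N (j - 1)) (N j)
    have h4 := Finset.le_card_sdiff (T k) (N j \ N (j - 1))
    have h5 := Finset.le_card_sdiff (G.nbhd {x}) ((N j \ N (j - 1)) \ T k)
    have h6 := hΔ x
    have h7 : (2 * j + 1) * β = (2 * (j - 1) + 1) * β + 2 * β := by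
      obtain ⟨i, rfl⟩ : ∃ i, j = i + 1 := ⟨j - 1, by omega⟩
      rw [Nat.add_sub_cancel]
      ring
    simp only [hY]
    omega
  have hYmem : ∀ j, 1 ≤ j → j ≤ k → ∀ y ∈ Y j, y ∈ G.nbhd (T j) ∧ y ∉ N (j - 1) ∧
      y ∉ Z ∧ ¬ G.Adj x y ∧ x ≠ y := by
    intro j hj hjk y hy
    simp only [hY, Finset.mem_sdiff] at hy
    obtain ⟨⟨⟨h1, h2⟩, h3⟩, h4⟩ := hy
    refine ⟨?_, h2, fun hyZ => hZN y hyZ (hNmono hjk le_rfl h1), fun hadj => ?_, ?_⟩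
    · rcases Finset.mem_union.1 h1 with h5 | h5
      · exact absurd (chain_subset hTmono hjk le_rfl h5) h3
      · exact h5
    · exact h4 (mem_nbhd.2 ⟨x, Finset.mem_singleton_self x, hadj⟩)
    · rintro rfl
      exact h2 (hNmono (Nat.zero_le _) (by omega) hxN)
  -- the number of steps needed from `x`
  set M : ℕ → ℕ → Finset V := fun j l => (Y j).filter
    (fun y => G.WalkThrough Z l x y ∧ ∀ a < l, ¬ G.WalkThrough Z a x y) with hM
  have hexl : ∀ j ∈ Finset.Icc 1 k, ∃ l ∈ Finset.Icc 2 (K + 1), μ ≤ (M j l).card := by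
    intro j hj
    rw [Finset.mem_Icc] at hj
    by_contra hcon
    push Not at hcon
    have h1 := h.card_lt_card_nbhd_inter hx (Y j)
    have h2 : G.nbhd R ∩ Y j ⊆ (Finset.Icc 2 (K + 1)).biUnion (M j) := by
      intro y hy
      obtain ⟨hyR, hyY⟩ := Finset.mem_inter.1 hy
      obtain ⟨r, hr, hry⟩ := mem_nbhd.1 hyR
      obtain ⟨⟨p, hp⟩, hrZ⟩ := hRw r hr
      have hex : ∃ a, G.WalkThrough Z a x y := ⟨K + 1, _, hp.extend (fun _ => hrZ) hry⟩
      have hle : Nat.find hex ≤ K + 1 := Nat.find_min' hex ⟨_, hp.extend (fun _ => hrZ) hry⟩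
      have hmem := hYmem j hj.1 hj.2 y hyY
      have h2l : 2 ≤ Nat.find hex := by
        by_contra hlt
        obtain ⟨p, hp⟩ := Nat.find_spec hex
        have : Nat.find hex = 0 ∨ Nat.find hex = 1 := by omega
        rcases this with e | e <;> rw [e] at hp
        · exact hmem.2.2.2.2 (hp.1.symm.trans hp.2.1)
        · have := hp.2.2.1 0 (by omega)
          rw [hp.1, hp.2.1] at this
          exact hmem.2.2.2.1 this
      exact Finset.mem_biUnion.2 ⟨Nat.find hex, Finset.mem_Icc.2 ⟨h2l, hle⟩,
        Finset.mem_filter.2 ⟨hyY, Nat.find_spec hex, fun a ha => Nat.find_min hex ha⟩⟩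
    have h3 := Finset.card_le_card h2
    have h4 : ((Finset.Icc 2 (K + 1)).biUnion (M j)).card ≤ (Finset.Icc 2 (K + 1)).card * μ :=
      Finset.card_biUnion_le_card_mul _ _ _ fun l hl => (hcon l hl).le
    have h5 := hYcard j hj.1 hj.2
    rw [Nat.card_Icc, show K + 1 + 1 - 2 = K by omega] at h4
    omega
  -- There are K possible lengths and K(K + 1) + 1 blocks, so some length l is chosen by at least K
  -- + 2 blocks.
  choose! L hL hML using hexl
  obtain ⟨l, hl, hfib⟩ := Finset.exists_lt_card_fiber_of_mul_lt_card_of_maps_to hL (n := K + 1)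
    (by rw [Nat.card_Icc, Nat.card_Icc, hk, show K + 1 + 1 - 2 = K by omega]; omega)
  obtain ⟨J, hJ, hJcard⟩ := Finset.exists_subset_card_eq (Nat.succ_le_of_lt hfib)
  set e := J.orderEmbOfFin hJcard with he
  have hlI := Finset.mem_Icc.1 hl
  -- Blocks in decreasing order, so that each vertex is anticomplete to the T of every later block.
  -- Truncated subtraction makes `idx` constant beyond K + 1.
  set idx : ℕ → ℕ := fun i => e ⟨K + 1 - i, by omega⟩ with hidx
  have hidxJ : ∀ i, 1 ≤ idx i ∧ idx i ≤ k ∧ μ ≤ (M (idx i) l).card := by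
    intro i
    have h1 := Finset.mem_filter.1 (hJ (J.orderEmbOfFin_mem hJcard ⟨K + 1 - i, by omega⟩))
    have h2 := Finset.mem_Icc.1 h1.1
    refine ⟨h2.1, h2.2, ?_⟩
    have h3 := hML _ h1.1
    rwa [h1.2] at h3
  have hidxlt : ∀ i < K + 1, idx (i + 1) < idx i := by
    intro i hi
    refine e.lt_iff_lt.2 ?_
    rw [Fin.mk_lt_mk]
    omega
  set B : ℕ → Finset V := fun i => M (idx i) l with hB
  obtain ⟨y₀, hy₀, hreach⟩ := h.exists_reach hm hD hmD (B := B)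
    (by have := (hidxJ 0).2.2; simp only [hB]; omega)
    (fun i _ _ => by have := (hidxJ i).2.2; simp only [hB]; omega)
  have hBmem : ∀ i, ∀ y ∈ B i, y ∈ Y (idx i) ∧ G.WalkThrough Z l x y ∧
      ∀ a < l, ¬ G.WalkThrough Z a x y := fun i y hy => Finset.mem_filter.1 hy
  obtain ⟨p, hp⟩ := (hBmem 0 y₀ hy₀).2.1
  have hqZ : p (l - 1) ∈ Z := hp.2.2.2 (l - 1) (by omega) (by omega)
  have hqw : G.WalkThrough Z (l - 1) x (p (l - 1)) := ⟨p, hp.prefix (by omega)⟩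
  have hqy₀ : G.Adj (p (l - 1)) y₀ := by
    have := hp.2.2.1 (l - 1) (by omega)
    rwa [show l - 1 + 1 = l by omega, hp.2.1] at this
  -- Adjacency to q = `p (l - 1)` is inherited along every walk through the blocks.
  have key : ∀ i ≤ K + 1, ∀ y ∈ G.reach B i {y₀}, y ∈ B i ∧ G.Adj (p (l - 1)) y := by
    intro i
    induction i with
    | zero =>
      intro _ y hy
      obtain rfl := Finset.mem_singleton.1 hy
      exact ⟨hy₀, hqy₀⟩
    | succ i ih =>
      intro hi y' hy'
      obtain ⟨⟨y, hy, hyy'⟩, hy'B⟩ := mem_reach_succ.1 hy'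
      obtain ⟨hyB, hqy⟩ := ih (by omega) y hy
      refine ⟨hy'B, ?_⟩
      obtain ⟨hyY, -, hymin⟩ := hBmem i y hyB
      obtain ⟨hy'Y, hy'l, hy'min⟩ := hBmem (i + 1) y' hy'B
      have hlt := hidxlt i (by omega)
      obtain ⟨hi1, hik, -⟩ := hidxJ i
      obtain ⟨hi1', hik', -⟩ := hidxJ (i + 1)
      obtain ⟨-, hyN, -, -, -⟩ := hYmem _ hi1 hik y hyY
      obtain ⟨hy'nb, -, hy'Z, hxy', hxne⟩ := hYmem _ hi1' hik' y' hy'Y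
      have hsep : ∀ v j, j ≤ k → v ∉ N j → ∀ t ∈ T j, v ≠ t ∧ ¬ G.Adj v t := by
        intro v j _ hv t ht
        refine ⟨fun e => hv (Finset.mem_union_left _ (e ▸ ht)), fun hadj => hv ?_⟩
        exact Finset.mem_union_right _ (mem_nbhd.2 ⟨t, ht, hadj.symm⟩)
      refine hG.adj_of_shortest (T := T (idx (i + 1))) ?_ ?_ hlI.1 hxy' hxne hy'Z hymin hy'min
        hy'l hqw hqZ hqy hyy' ?_
      · exact fun z hz => hsep z _ hik' fun hzN => hZN z hz (hNmono hik' le_rfl hzN)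
      · exact hsep y _ hik' fun hzN => hyN (hNmono (by omega) (by omega) hzN)
      · exact (hT _ hik').1.exists_walkThrough
          (nbhd_mono (chain_subset hTmono (Nat.zero_le _) hik') hxnb) hy'nb
  -- So q has more than μ - 2m = Dm + Δ neighbours in the last block.
  have h1 := h.card_lt_card_nbhd_inter hreach (B (K + 1))
  have h2 : G.nbhd (G.reach B K {y₀}) ∩ B (K + 1) ⊆ G.nbhd {p (l - 1)} := by
    intro y hy
    obtain ⟨hy1, hy2⟩ := Finset.mem_inter.1 hy
    have := key (K + 1) le_rfl y (mem_reach_succ.2 ⟨mem_nbhd.1 hy1, hy2⟩)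
    exact mem_nbhd.2 ⟨_, Finset.mem_singleton_self _, this.2⟩
  have h3 := Finset.card_le_card h2
  have h4 := hΔ (p (l - 1))
  have h5 : μ ≤ (B (K + 1)).card := (hidxJ (K + 1)).2.2
  omega

end SimpleGraph

/-! ### Greedy embedding of a pattern. -/

namespace SimpleGraph

open Classical in
/-- The number of neighbours of `v` in `S`. -/
noncomputable def degIn {V : Type*} (G : SimpleGraph V) (v : V) (S : Finset V) : ℕ :=
  (S.filter (G.Adj v)).card

section Greedy

variable {V : Type*} {G : SimpleGraph V}

theorem degIn_mono {v : V} {S S' : Finset V} (h : S ⊆ S') : G.degIn v S ≤ G.degIn v S' := by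
  classical
  exact Finset.card_le_card (Finset.filter_subset_filter _ h)

theorem degIn_le_card (v : V) (S : Finset V) : G.degIn v S ≤ S.card := by
  classical
  exact Finset.card_filter_le _ _

theorem degIn_union [DecidableEq V] {v : V} {S S' : Finset V} (h : Disjoint S S') :
    G.degIn v (S ∪ S') = G.degIn v S + G.degIn v S' := by
  classical
  unfold degIn
  rw [Finset.filter_union, Finset.card_union_of_disjoint (Finset.disjoint_filter_filter h)]

theorem sum_degIn_comm (A B : Finset V) :
    ∑ v ∈ A, G.degIn v B = ∑ u ∈ B, G.degIn u A := by
  classical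
  simp only [degIn, Finset.card_filter]
  rw [Finset.sum_comm]
  simp only [G.adj_comm]

/-- Greedy embedding: if no two large disjoint sets have very low or very high density, then every
pattern occurs as a transversal of large disjoint sets. -/
theorem exists_transversal [Nonempty V] {ε a : ℝ} (hε0 : 0 < ε) (hε1 : ε ≤ 1) (ha : 0 < a)
    {h₀ : ℕ} {X : Finset V}
    (hpair : ∀ A B : Finset V, A ⊆ X → B ⊆ X → Disjoint A B → a ≤ A.card → a ≤ B.card →
      (∃ v ∈ A, ε * B.card < G.degIn v B) ∧ (∃ v ∈ A, ε * B.card < Gᶜ.degIn v B)) (h : ℕ)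
    (hh : h ≤ h₀) (P : ℕ → ℕ → Prop) (U : ℕ → Finset V)
    (hUX : ∀ i < h, U i ⊆ X) (hdisj : ∀ i j, i < j → j < h → Disjoint (U i) (U j))
    (hU : ∀ i < h, a * h₀ ≤ ε ^ h * (U i).card) :
    ∃ f : ℕ → V, (∀ i < h, f i ∈ U i) ∧ ∀ i j, i < j → j < h → (G.Adj (f i) (f j) ↔ P i j) := by
  classical
  induction h generalizing P U with
  | zero => exact ⟨fun _ => Classical.arbitrary V, by simp, by simp⟩
  | succ h ih =>
    have hUa : ∀ i < h + 1, a * h₀ ≤ (U i).card := fun i hi =>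
      (hU i hi).trans (mul_le_of_le_one_left (Nat.cast_nonneg _) (pow_le_one₀ hε0.le hε1))
    have h₀1 : (h : ℝ) + 1 ≤ h₀ := by exact_mod_cast hh
    have hh0 : (0 : ℝ) ≤ h := Nat.cast_nonneg h
    have hUa' : ∀ i < h + 1, a ≤ (U i).card := fun i hi =>
      (le_mul_of_one_le_right ha.le (by linarith)).trans (hUa i hi)
    set S : ℕ → V → Finset V := fun j v => (U j).filter (fun u => G.Adj v u ↔ P 0 j) with hS
    -- For each j at most a vertices of `U 0` leave too few candidates in `U j`. These are at most
    -- ha in total, fewer than `U 0` has; a good choice shrinks every other set by a factor of at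
    -- most ε.
    obtain ⟨v, hv, hgood⟩ : ∃ v ∈ U 0, ∀ j, 1 ≤ j → j ≤ h →
        ε * (U j).card ≤ (S j v).card := by
      by_contra hcon
      push Not at hcon
      set bad : ℕ → Finset V := fun j =>
        (U 0).filter (fun v => ((S j v).card : ℝ) < ε * (U j).card) with hbad
      have hsub : U 0 ⊆ (Finset.Icc 1 h).biUnion bad := by
        intro v hv
        obtain ⟨j, h1, h2, h3⟩ := hcon v hv
        exact Finset.mem_biUnion.2 ⟨j, Finset.mem_Icc.2 ⟨h1, h2⟩, Finset.mem_filter.2 ⟨hv, h3⟩⟩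
      have hbadcard : ∀ j ∈ Finset.Icc 1 h, ((bad j).card : ℝ) ≤ a := by
        intro j hj
        rw [Finset.mem_Icc] at hj
        by_contra hlt
        have hd : Disjoint (bad j) (U j) :=
          (hdisj 0 j (by omega) (by omega)).mono_left (Finset.filter_subset _ _)
        obtain ⟨⟨v, hv, hv'⟩, w, hw, hw'⟩ :=
          hpair (bad j) (U j) ((Finset.filter_subset _ _).trans (hUX 0 (by omega)))
            (hUX j (by omega)) hd (not_le.1 hlt).le (hUa' j (by omega))
        by_cases hP : P 0 j
        · have h1 := (Finset.mem_filter.1 hv).2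
          have h2 : S j v = (U j).filter (G.Adj v) := by
            simp only [hS, hP, iff_true]
          rw [h2] at h1
          unfold degIn at hv'
          linarith
        · have h1 := (Finset.mem_filter.1 hw).2
          have h2 : S j w = (U j).filter (Gᶜ.Adj w) := by
            simp only [hS, hP, iff_false]
            refine Finset.filter_congr fun u hu => ?_
            rw [compl_adj]
            exact ⟨fun h3 => ⟨fun e => Finset.disjoint_left.1 hd hw (e ▸ hu), h3⟩, fun h3 => h3.2⟩
          have h3 : (S j w).card = Gᶜ.degIn w (U j) := by
            rw [h2, degIn]
            congr
          rw [h3] at h1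
          linarith
      have h1 : ((U 0).card : ℝ) ≤ ∑ j ∈ Finset.Icc 1 h, ((bad j).card : ℝ) := by
        exact_mod_cast (Finset.card_le_card hsub).trans Finset.card_biUnion_le
      have h2 := h1.trans (Finset.sum_le_card_nsmul _ _ _ hbadcard)
      rw [Nat.card_Icc, Nat.add_sub_cancel, nsmul_eq_mul] at h2
      have h3 := hUa 0 (by omega)
      nlinarith
    obtain ⟨f, hf1, hf2⟩ := ih (by omega) (fun i j => P (i + 1) (j + 1)) (fun j => S (j + 1) v)
      (fun i hi => (Finset.filter_subset _ _).trans (hUX (i + 1) (by omega)))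
      (fun i j hij hj => (hdisj (i + 1) (j + 1) (by omega) (by omega)).mono
        (Finset.filter_subset _ _) (Finset.filter_subset _ _)) (by
      intro i hi
      refine (hU (i + 1) (by omega)).trans ?_
      rw [pow_succ, mul_assoc]
      exact mul_le_mul_of_nonneg_left (hgood (i + 1) (by omega) (by omega)) (by positivity))
    refine ⟨fun n => Nat.casesOn n v f, ?_, ?_⟩
    · rintro (_ | i) hi
      · exact hv
      · exact (Finset.mem_filter.1 (hf1 i (by omega))).1
    · rintro (_ | i) (_ | j) hij hj
      · omega
      · exact (Finset.mem_filter.1 (hf1 j (by omega))).2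
      · omega
      · exact hf2 i j (by omega) (by omega)

theorem exists_disjoint_subsets (s h : ℕ) (X : Finset V) (hX : h * s ≤ X.card) :
    ∃ U : ℕ → Finset V, (∀ i < h, U i ⊆ X ∧ (U i).card = s) ∧
      ∀ i j, i < j → j < h → Disjoint (U i) (U j) := by
  classical
  induction h generalizing X with
  | zero => exact ⟨fun _ => ∅, by simp, by simp⟩
  | succ h ih =>
    rw [Nat.add_mul, one_mul] at hX
    obtain ⟨A, hA, hAs⟩ := Finset.exists_subset_card_eq (show s ≤ X.card by omega)
    obtain ⟨U, hU1, hU2⟩ := ih (X \ A) (by rw [Finset.card_sdiff_of_subset hA]; omega)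
    refine ⟨fun i => if i < h then U i else A, fun i hi => ?_, fun i j hij hj => ?_⟩
    · dsimp only
      split_ifs with hih
      · exact ⟨(hU1 i hih).1.trans Finset.sdiff_subset, (hU1 i hih).2⟩
      · exact ⟨hA, hAs⟩
    · dsimp only
      rw [if_pos (by omega)]
      split_ifs with hjh
      · exact hU2 i j hij hjh
      · exact Finset.disjoint_of_subset_left (hU1 i (by omega)).1 Finset.sdiff_disjoint

/-- Without an induced pentagon there are two sets of linear size with very low or very high
density between them. -/
theorem exists_pair_of_no_pentagon (hG : ∀ f, ¬ G.IsHole 5 f) {ε : ℝ} (hε0 : 0 < ε)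
    (hε1 : ε ≤ 1) {X : Finset V} (hX : 5 ≤ X.card) :
    ∃ A B : Finset V, A ⊆ X ∧ B ⊆ X ∧ Disjoint A B ∧ A.card ≤ B.card ∧
      ε ^ 5 / 50 * X.card ≤ A.card ∧
      ((∀ v ∈ A, (G.degIn v B : ℝ) ≤ ε * B.card) ∨
        (∀ v ∈ A, (Gᶜ.degIn v B : ℝ) ≤ ε * B.card)) := by
  classical
  have hXpos : (0 : ℝ) < X.card := by exact_mod_cast (by omega : 0 < X.card)
  -- Five parts of size ⌊|X|/5⌋ ≥ |X|/10 must satisfy 5a ≤ ε^5 |X|/10, hence the constant 1/50.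
  have key : ∃ A B : Finset V, A ⊆ X ∧ B ⊆ X ∧ Disjoint A B ∧ ε ^ 5 / 50 * X.card ≤ A.card ∧
      ε ^ 5 / 50 * X.card ≤ B.card ∧ ((∀ v ∈ A, (G.degIn v B : ℝ) ≤ ε * B.card) ∨
        (∀ v ∈ A, (Gᶜ.degIn v B : ℝ) ≤ ε * B.card)) := by
    by_contra hcon
    push Not at hcon
    obtain ⟨U, hU1, hU2⟩ := exists_disjoint_subsets (X.card / 5) 5 X (Nat.mul_div_le _ _)
    obtain ⟨x, hx⟩ := Finset.card_pos.1 (show 0 < X.card by omega)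
    have : Nonempty V := ⟨x⟩
    obtain ⟨f, hf1, hf2⟩ := exists_transversal (G := G) (ε := ε) (a := ε ^ 5 / 50 * X.card) hε0 hε1
      (by positivity) (h₀ := 5) hcon 5 le_rfl (fun i j => j = i + 1 ∨ (i = 0 ∧ j + 1 = 5)) U
      (fun i hi => (hU1 i hi).1) hU2 (by
        intro i hi
        rw [(hU1 i hi).2]
        have h1 : X.card ≤ 10 * (X.card / 5) := by omega
        have h2 : (X.card : ℝ) ≤ 10 * ((X.card / 5 : ℕ) : ℝ) := by exact_mod_cast h1
        have h3 : 0 < ε ^ 5 := by positivity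
        push_cast
        nlinarith)
    refine hG f fun i j hij hj => ⟨fun he => ?_, hf2 i j hij hj⟩
    exact Finset.disjoint_left.1 (hU2 i j hij hj) (hf1 i (by omega)) (he ▸ hf1 j hj)
  obtain ⟨A, B, hA, hB, hAB, hAc, hBc, hdens⟩ := key
  obtain ⟨A', hA', hA'c⟩ := Finset.exists_subset_card_eq (min_le_left A.card B.card)
  refine ⟨A', B, hA'.trans hA, hB, hAB.mono_left hA', hA'c ▸ min_le_right _ _, ?_, ?_⟩
  · rw [hA'c, Nat.cast_min]
    exact le_min hAc hBc
  · exact hdens.imp (fun h v hv => h v (hA' hv)) fun h v hv => h v (hA' hv)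

/-- Repeatedly taking the element with the smallest value keeps the average at most that of B. -/
theorem exists_subset_sum_le (g : V → ℝ) (B : Finset V) {s : ℕ} (hs : s ≤ B.card) :
    ∃ B' ⊆ B, B'.card = s ∧ B.card * ∑ v ∈ B', g v ≤ s * ∑ v ∈ B, g v := by
  classical
  induction s with
  | zero => exact ⟨∅, by simp, by simp, by simp⟩
  | succ s ih =>
    obtain ⟨B', hB', hcard, hsum⟩ := ih (by omega)
    have hne : (B \ B').Nonempty := by
      rw [← Finset.card_pos, Finset.card_sdiff_of_subset hB']
      omega
    obtain ⟨b, hb, hmin⟩ := (B \ B').exists_min_image g hne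
    obtain ⟨hbB, hbB'⟩ := Finset.mem_sdiff.1 hb
    refine ⟨insert b B', Finset.insert_subset hbB hB', ?_, ?_⟩
    · rw [Finset.card_insert_of_notMem hbB', hcard]
    · rw [Finset.sum_insert hbB']
      have h1 := Finset.card_nsmul_le_sum (B \ B') g (g b) hmin
      rw [nsmul_eq_mul, Finset.card_sdiff_of_subset hB', Nat.cast_sub (Finset.card_le_card hB'),
        hcard] at h1
      have h2 := Finset.sum_sdiff (f := g) hB'
      rw [← h2] at hsum ⊢
      set P := ∑ x ∈ B', g x
      set R := ∑ x ∈ B \ B', g x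
      have hs' : (s : ℝ) + 1 ≤ B.card := by exact_mod_cast hs
      have hpos : (0 : ℝ) < B.card - s := by linarith
      have hc0 : (0 : ℝ) ≤ B.card := Nat.cast_nonneg _
      have h3 : (0 : ℝ) ≤ B.card - s - 1 := by linarith
      refine le_of_mul_le_mul_left ?_ hpos
      have h4 := mul_le_mul_of_nonneg_left h1 hc0
      have h5 := mul_le_mul_of_nonneg_left hsum h3
      push_cast
      nlinarith

end Greedy

end SimpleGraph

/-! ### Rödl's theorem for the pentagon. -/

namespace SimpleGraph

section Blocks

variable {V : Type*} {G : SimpleGraph V}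

/-- `X` contains a set of `p * s` vertices with few edges: about as many as `p` disjoint sets of
size `s` with density at most `ε` between them can have. -/
def HasSparseBlocks (G : SimpleGraph V) (ε : ℝ) (X : Finset V) (s p : ℕ) : Prop :=
  ∃ W ⊆ X, W.card = p * s ∧
    ((∑ v ∈ W, G.degIn v W : ℕ) : ℝ) ≤ (p + ε * p ^ 2) * (s : ℝ) ^ 2

theorem hasSparseBlocks_zero (ε : ℝ) (X : Finset V) (s : ℕ) : G.HasSparseBlocks ε X s 0 :=
  ⟨∅, by simp, by simp, by simp⟩

theorem HasSparseBlocks.mono {ε : ℝ} {X X' : Finset V} {s p : ℕ} (hX : X ⊆ X')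
    (h : G.HasSparseBlocks ε X s p) : G.HasSparseBlocks ε X' s p := by
  obtain ⟨W, hW, h⟩ := h
  exact ⟨W, hW.trans hX, h⟩

/-- Add the s vertices of B with the fewest neighbours in W. Degree sums grow by at most s² inside
the new block and 2εps² across, and p² + 2p ≤ (p + 1)². -/
theorem HasSparseBlocks.succ {ε : ℝ} (hε : 0 ≤ ε) {X A B : Finset V} {s p : ℕ}
    (h : G.HasSparseBlocks ε A s p) (hAX : A ⊆ X) (hBX : B ⊆ X) (hAB : Disjoint A B)
    (hdeg : ∀ v ∈ A, (G.degIn v B : ℝ) ≤ ε * B.card) (hs : s ≤ B.card) :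
    G.HasSparseBlocks ε X s (p + 1) := by
  classical
  obtain ⟨W, hWA, hWc, hWe⟩ := h
  obtain ⟨B', hB', hB'c, hB's⟩ := exists_subset_sum_le (fun u => (G.degIn u W : ℝ)) B hs
  have hWB : Disjoint W B' := hAB.mono hWA hB'
  have h1 : ∑ u ∈ B, (G.degIn u W : ℝ) ≤ W.card * (ε * B.card) := by
    have : ∑ u ∈ B, (G.degIn u W : ℝ) = ∑ v ∈ W, (G.degIn v B : ℝ) := by
      exact_mod_cast sum_degIn_comm (G := G) B W
    rw [this]
    refine (Finset.sum_le_card_nsmul _ _ _ fun v hv => hdeg v (hWA hv)).trans_eq ?_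
    rw [nsmul_eq_mul]
  have h2 : ∑ u ∈ B', (G.degIn u W : ℝ) ≤ ε * p * (s : ℝ) ^ 2 := by
    rcases Nat.eq_zero_or_pos B.card with h0 | h0
    · have : B' = ∅ := by
        rw [← Finset.card_eq_zero]
        have := Finset.card_le_card hB'
        omega
      rw [this, Finset.sum_empty]
      positivity
    · have h0' : (0 : ℝ) < B.card := by exact_mod_cast h0
      refine le_of_mul_le_mul_left ?_ h0'
      refine hB's.trans ((mul_le_mul_of_nonneg_left h1 (Nat.cast_nonneg s)).trans_eq ?_)
      rw [hWc]
      push_cast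
      ring
  have h3 : ∑ v ∈ W, (G.degIn v B' : ℝ) = ∑ u ∈ B', (G.degIn u W : ℝ) := by
    exact_mod_cast sum_degIn_comm (G := G) W B'
  have h4 : ∑ u ∈ B', (G.degIn u B' : ℝ) ≤ (s : ℝ) ^ 2 := by
    refine (Finset.sum_le_card_nsmul _ _ (s : ℝ) fun v _ => ?_).trans_eq ?_
    · exact_mod_cast hB'c ▸ degIn_le_card v B'
    · rw [nsmul_eq_mul, hB'c, sq]
  refine ⟨W ∪ B', Finset.union_subset (hWA.trans hAX) (hB'.trans hBX), ?_, ?_⟩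
  · rw [Finset.card_union_of_disjoint hWB, hWc, hB'c]
    ring
  · rw [Finset.sum_union hWB]
    simp only [degIn_union hWB, Finset.sum_add_distrib]
    push_cast at hWe ⊢
    nlinarith [mul_nonneg hε (sq_nonneg (s : ℝ))]

end Blocks

/-- Ramsey-type double induction: recurse into the side A of a sparse or dense pair; if the kind of
blocks found there matches the pair, B supplies one more. The pair has |A| ≤ |B|, so s ≤ |B|. -/
theorem exists_sparse_or_dense_blocks {ε : ℝ} (hε0 : 0 < ε) (hε1 : ε ≤ 1) (p q : ℕ) :
    ∃ δ : ℝ, 0 < δ ∧ ∃ N : ℕ, ∀ (V : Type u) (G : SimpleGraph V), (∀ f, ¬ G.IsHole 5 f) →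
      ∀ X : Finset V, N ≤ X.card → ∃ s : ℕ, s ≤ X.card ∧ δ * X.card ≤ s ∧
        (G.HasSparseBlocks ε X s p ∨ Gᶜ.HasSparseBlocks ε X s q) := by
  induction p generalizing q with
  | zero =>
    exact ⟨1, one_pos, 0, fun V G _ X _ => ⟨X.card, le_rfl, by simp,
      Or.inl (hasSparseBlocks_zero _ _ _)⟩⟩
  | succ p ihp =>
    induction q with
    | zero =>
      exact ⟨1, one_pos, 0, fun V G _ X _ => ⟨X.card, le_rfl, by simp,
        Or.inr (hasSparseBlocks_zero _ _ _)⟩⟩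
    | succ q ihq =>
      obtain ⟨δ₁, hδ₁, N₁, h₁⟩ := ihp (q + 1)
      obtain ⟨δ₂, hδ₂, N₂, h₂⟩ := ihq
      set η := ε ^ 5 / 50 with hη
      have hη0 : 0 < η := by positivity
      obtain ⟨N, hN⟩ := exists_nat_ge (((max N₁ N₂ : ℕ) : ℝ) / η)
      refine ⟨min δ₁ δ₂ * η, by positivity, max 5 N, fun V G hG X hX => ?_⟩
      obtain ⟨A, B, hA, hB, hAB, hcard, hAc, hdens⟩ := exists_pair_of_no_pentagon hG hε0 hε1
        ((le_max_left 5 N).trans hX)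
      have hNA : max N₁ N₂ ≤ A.card := by
        have h1 : (N : ℝ) ≤ X.card := by exact_mod_cast (le_max_right 5 N).trans hX
        have h2 : ((max N₁ N₂ : ℕ) : ℝ) ≤ A.card := by
          refine le_trans ?_ hAc
          rw [mul_comm, ← div_le_iff₀ hη0]
          exact hN.trans h1
        exact_mod_cast h2
      have hAX := Finset.card_le_card hA
      have hδ : ∀ δ s : ℝ, min δ₁ δ₂ ≤ δ → δ * A.card ≤ s → min δ₁ δ₂ * η * X.card ≤ s := by
        intro δ s hδ hs
        refine le_trans ?_ hs
        rw [mul_assoc]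
        exact mul_le_mul hδ hAc (by positivity) ((lt_min hδ₁ hδ₂).le.trans hδ)
      rcases hdens with hd | hd
      · obtain ⟨s, hsA, hs, hs' | hs'⟩ := h₁ V G hG A ((le_max_left _ _).trans hNA)
        · exact ⟨s, hsA.trans hAX, hδ _ _ (min_le_left _ _) hs,
            Or.inl (hs'.succ hε0.le hA hB hAB hd (hsA.trans hcard))⟩
        · exact ⟨s, hsA.trans hAX, hδ _ _ (min_le_left _ _) hs, Or.inr (hs'.mono hA)⟩
      · obtain ⟨s, hsA, hs, hs' | hs'⟩ := h₂ V G hG A ((le_max_right _ _).trans hNA)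
        · exact ⟨s, hsA.trans hAX, hδ _ _ (min_le_right _ _) hs, Or.inl (hs'.mono hA)⟩
        · exact ⟨s, hsA.trans hAX, hδ _ _ (min_le_right _ _) hs,
            Or.inr (hs'.succ hε0.le hA hB hAB hd (hsA.trans hcard))⟩

/-- As p ≥ 8/ε, the degree sum is at most ε|W|²/4, so at most half of W has degree above ε|W|/2;
delete these vertices. -/
theorem HasSparseBlocks.exists_degIn_le {V : Type*} {G : SimpleGraph V} {ε : ℝ} (hε : 0 < ε)
    {X : Finset V} {s p : ℕ} (hp : 8 / ε ≤ p) (h : G.HasSparseBlocks (ε / 8) X s p) :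
    ∃ W ⊆ X, (s : ℝ) / 2 ≤ W.card ∧ ∀ v ∈ W, (G.degIn v W : ℝ) ≤ ε * W.card := by
  classical
  obtain ⟨W, hWX, hWc, hWe⟩ := h
  have hp8 : 8 ≤ p * ε := (div_le_iff₀ hε).1 hp
  have hp0 : (0 : ℝ) < p := (by positivity : (0 : ℝ) < 8 / ε).trans_le hp
  have hp1 : (1 : ℝ) ≤ p := by exact_mod_cast (by exact_mod_cast hp0 : 0 < p)
  have hWcR : (W.card : ℝ) = p * s := by exact_mod_cast hWc
  rcases Nat.eq_zero_or_pos s with rfl | hs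
  · exact ⟨∅, by simp, by simp, by simp⟩
  have hs0 : (0 : ℝ) < s := by exact_mod_cast hs
  have hW0 : (0 : ℝ) < W.card := by rw [hWcR]; positivity
  set bad := W.filter (fun v => ε / 2 * W.card < G.degIn v W) with hbad
  set W' := W.filter (fun v => ¬ ε / 2 * W.card < G.degIn v W) with hW'
  have hsum : bad.card * (ε / 2 * W.card) ≤ ((∑ v ∈ W, G.degIn v W : ℕ) : ℝ) := by
    have h1 := Finset.card_nsmul_le_sum bad (fun v => (G.degIn v W : ℝ)) (ε / 2 * W.card)
      fun v hv => (Finset.mem_filter.1 hv).2.le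
    rw [nsmul_eq_mul] at h1
    refine h1.trans ?_
    push_cast
    exact Finset.sum_le_sum_of_subset_of_nonneg (Finset.filter_subset _ _)
      fun _ _ _ => Nat.cast_nonneg _
  have hbadc : (bad.card : ℝ) ≤ W.card / 2 := by
    have h2 : (p + ε / 8 * (p : ℝ) ^ 2) * (s : ℝ) ^ 2 ≤ ε / 4 * (W.card : ℝ) ^ 2 := by
      rw [hWcR]
      have : (p : ℝ) ≤ ε / 8 * p ^ 2 := by nlinarith
      nlinarith [sq_nonneg (s : ℝ)]
    have h3 := hsum.trans (hWe.trans h2)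
    have h4 : (0 : ℝ) < ε / 2 * W.card := by positivity
    refine le_of_mul_le_mul_right ?_ h4
    nlinarith
  have hsplit : (bad.card : ℝ) + W'.card = W.card := by
    exact_mod_cast Finset.card_filter_add_card_filter_not _
  refine ⟨W', (Finset.filter_subset _ _).trans hWX, ?_, fun v hv => ?_⟩
  · have : (s : ℝ) ≤ W.card := by
      rw [hWcR]
      nlinarith
    linarith
  · have h1 := not_lt.1 (Finset.mem_filter.1 hv).2
    have h2 : (G.degIn v W' : ℝ) ≤ G.degIn v W := by
      exact_mod_cast degIn_mono (Finset.filter_subset _ _)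
    nlinarith

/-- Rödl's theorem for the pentagon: some set of linear size is very sparse or very dense. -/
theorem exists_sparse_or_dense {ε : ℝ} (hε0 : 0 < ε) (hε1 : ε ≤ 1) :
    ∃ δ : ℝ, 0 < δ ∧ ∃ N : ℕ, ∀ (V : Type u) (G : SimpleGraph V), (∀ f, ¬ G.IsHole 5 f) →
      ∀ X : Finset V, N ≤ X.card → ∃ W ⊆ X, δ * X.card ≤ W.card ∧
        ((∀ v ∈ W, (G.degIn v W : ℝ) ≤ ε * W.card) ∨
          ∀ v ∈ W, (Gᶜ.degIn v W : ℝ) ≤ ε * W.card) := by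
  obtain ⟨p, hp⟩ := exists_nat_ge (8 / ε)
  obtain ⟨δ, hδ, N, h⟩ := exists_sparse_or_dense_blocks.{u} (ε := ε / 8) (by positivity)
    (by linarith) p p
  refine ⟨δ / 2, by positivity, N, fun V G hG X hX => ?_⟩
  obtain ⟨s, -, hs, hs' | hs'⟩ := h V G hG X hX
  · obtain ⟨W, hWX, hWs, hW⟩ := hs'.exists_degIn_le hε0 hp
    exact ⟨W, hWX, by linarith, Or.inl hW⟩
  · obtain ⟨W, hWX, hWs, hW⟩ := hs'.exists_degIn_le hε0 hp
    exact ⟨W, hWX, by linarith, Or.inr hW⟩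

end SimpleGraph

/-! ### Choice of sizes, and the bound for fixed c. -/

namespace SimpleGraph

theorem OddHoleFree.induce {V : Type*} {G : SimpleGraph V} (h : G.OddHoleFree) (s : Set V) :
    (G.induce s).OddHoleFree := by
  intro l f hl hodd hole
  refine h l (fun i => (f i).1) hl hodd fun i j hij hj => ?_
  obtain ⟨h1, h2⟩ := hole i j hij hj
  exact ⟨fun he => h1 (Subtype.ext he), h2⟩

theorem OddHoleFree.exists_anticompleteTo {V : Type*} {G : SimpleGraph V} (hG : G.OddHoleFree)
    (W : Finset V) {m D K Δ β k : ℕ} (hm : 1 ≤ m)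
    (hD : 1 ≤ D) (hK : 1 ≤ K) (hmD : m ≤ D ^ K) (hΔ : ∀ v ∈ W, G.degIn v W + 1 ≤ Δ)
    (hk : k = K * (K + 1) + 1) (hβ : K * (D * m + 2 * m + Δ) + 3 * m + Δ ≤ β)
    (hn : (2 * k + 3) * β ≤ W.card) :
    ∃ A B : Finset V, Disjoint A B ∧ G.AnticompleteTo A B ∧ m ≤ A.card ∧ m ≤ B.card := by
  classical
  have h := (hG.induce (W : Set V)).not_edgeBetween hm hD hK hmD (Δ := Δ) (by
    intro v
    refine le_trans ?_ (hΔ v.1 v.2)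
    rw [Nat.add_le_add_iff_right, ← Finset.card_map (Function.Embedding.subtype _), degIn]
    refine Finset.card_le_card fun w hw => ?_
    obtain ⟨u, hu, rfl⟩ := Finset.mem_map.1 hw
    obtain ⟨t, ht, htu⟩ := mem_nbhd.1 hu
    rw [Finset.mem_singleton.1 ht] at htu
    exact Finset.mem_filter.2 ⟨u.2, htu⟩) hk hβ (by simpa using hn)
  unfold EdgeBetween at h
  push Not at h
  obtain ⟨A, B, hAB, hA, hB, hanti⟩ := h
  refine ⟨A.map (Function.Embedding.subtype _), B.map (Function.Embedding.subtype _),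
    (Finset.disjoint_map _).2 hAB, ?_, by rwa [Finset.card_map], by rwa [Finset.card_map]⟩
  intro a ha b hb
  obtain ⟨a', ha', rfl⟩ := Finset.mem_map.1 ha
  obtain ⟨b', hb', rfl⟩ := Finset.mem_map.1 hb
  exact hanti a' ha' b' hb'

/-- The sizes in `OddHoleFree.exists_anticompleteTo` for sets of linear size in a large graph. -/
theorem exists_anticompleteTo_of_sparse {c δ : ℝ} (hc0 : 0 < c) (hc1 : c ≤ 1) (hδ : 0 < δ) {K k : ℕ}
    (hK : 2 / c ≤ K) (hk : k = K * (K + 1) + 1) : ∃ N : ℕ, ∀ n : ℕ, N ≤ n →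
      ∀ (V : Type u) (G : SimpleGraph V), G.OddHoleFree → ∀ W : Finset V, δ * n ≤ W.card →
        (∀ v ∈ W, (G.degIn v W : ℝ) ≤ 1 / (4 * (2 * k + 3) * (K + 1)) * W.card) →
        ∃ A B : Finset V, Disjoint A B ∧ G.AnticompleteTo A B ∧
          (n : ℝ) ^ (1 - c) ≤ A.card ∧ (n : ℝ) ^ (1 - c) ≤ B.card := by
  set C : ℝ := 2 * k + 3 with hC
  have hC0 : 0 < C := by positivity
  have hlim : Tendsto (fun n : ℕ => (n : ℝ) ^ (c / 2)) atTop atTop :=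
    (tendsto_rpow_atTop (by positivity)).comp tendsto_natCast_atTop_atTop
  obtain ⟨N, hN⟩ := eventually_atTop.1
    (hlim.eventually_ge_atTop (14 * (K + 1) * (4 * C) / (3 * δ)))
  refine ⟨max N 1, fun n hn V G hG W hW hdeg => ?_⟩
  have hn1 : 1 ≤ n := (le_max_right _ _).trans hn
  have hn1' : (1 : ℝ) ≤ n := by exact_mod_cast hn1
  have hn0 : (0 : ℝ) < n := by linarith
  have hbig := hN n ((le_max_left _ _).trans hn)
  have hx1 : (1 : ℝ) ≤ (n : ℝ) ^ (c / 2) := Real.one_le_rpow hn1' (by positivity)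
  have hy1 : (1 : ℝ) ≤ (n : ℝ) ^ (1 - c) := Real.one_le_rpow hn1' (by linarith)
  have hz1 : (1 : ℝ) ≤ (n : ℝ) ^ (1 - c / 2) := Real.one_le_rpow hn1' (by linarith)
  have hxy : (n : ℝ) ^ (c / 2) * (n : ℝ) ^ (1 - c) = (n : ℝ) ^ (1 - c / 2) := by
    rw [← Real.rpow_add hn0]
    congr 1
    ring
  have hxz : (n : ℝ) ^ (c / 2) * (n : ℝ) ^ (1 - c / 2) = n := by
    rw [← Real.rpow_add hn0]
    ring_nf
    exact Real.rpow_one _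
  have hxK : (n : ℝ) ≤ ((n : ℝ) ^ (c / 2)) ^ K := by
    rw [← Real.rpow_natCast, ← Real.rpow_mul hn0.le]
    conv_lhs => rw [← Real.rpow_one (n : ℝ)]
    refine Real.rpow_le_rpow_of_exponent_le hn1' ?_
    have := (div_le_iff₀ hc0).1 hK
    linarith
  have hyn : (n : ℝ) ^ (1 - c) ≤ n := by
    conv_rhs => rw [← Real.rpow_one (n : ℝ)]
    exact Real.rpow_le_rpow_of_exponent_le hn1' (by linarith)
  generalize (n : ℝ) ^ (c / 2) = x at *
  generalize (n : ℝ) ^ (1 - c) = y at *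
  generalize (n : ℝ) ^ (1 - c / 2) = z at *
  set w : ℝ := (W.card : ℝ)
  have hKR : (2 : ℝ) ≤ K := by
    refine le_trans ?_ hK
    rw [le_div_iff₀ hc0]
    linarith
  have hK1 : 1 ≤ K := by exact_mod_cast (by linarith : (1 : ℝ) ≤ K)
  -- With D ≈ n^(c/2) and K ≥ 2/c one has D^K ≥ n ≥ m, while Dm = O(n^(1 - c/2)) is negligible
  -- against |W|.
  set m := ⌈y⌉₊ with hm
  set D := ⌈x⌉₊ with hD
  set ε : ℝ := 1 / (4 * C * (K + 1)) with hε
  have hε0 : 0 < ε := by positivity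
  have hmy : (m : ℝ) ≤ 2 * y := by
    have := (Nat.ceil_lt_add_one (by linarith : 0 ≤ y)).le
    linarith
  have hDx : (D : ℝ) ≤ 2 * x := by
    have := (Nat.ceil_lt_add_one (by linarith : 0 ≤ x)).le
    linarith
  have hm1 : 1 ≤ m := Nat.one_le_ceil_iff.2 (by linarith)
  have hD1 : 1 ≤ D := Nat.one_le_ceil_iff.2 (by linarith)
  have hmD : m ≤ D ^ K := by
    have h1 : m ≤ n := Nat.ceil_le.2 hyn
    refine h1.trans ?_
    have h2 : (n : ℝ) ≤ (D : ℝ) ^ K :=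
      hxK.trans (pow_le_pow_left₀ (by linarith) (Nat.le_ceil x) K)
    exact_mod_cast h2
  have hw0 : 0 ≤ w := Nat.cast_nonneg _
  set Δ := ⌊ε * w⌋₊ + 1 with hΔ
  have hΔw : (Δ : ℝ) ≤ ε * w + 1 := by
    rw [hΔ]
    push_cast
    linarith [Nat.floor_le (by positivity : 0 ≤ ε * w)]
  set β := ⌊w / C⌋₊ with hβ
  have hβw : w / C - 1 ≤ β := (Nat.sub_one_lt_floor _).le
  have hβw' : (β : ℝ) ≤ w / C := Nat.floor_le (by positivity)
  obtain ⟨A, B, hAB, hanti, hA, hB⟩ := hG.exists_anticompleteTo W hm1 hD1 hK1 hmD (Δ := Δ) (β := β)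
    (fun v hv => by
      rw [hΔ, Nat.add_le_add_iff_right]
      exact Nat.le_floor (hdeg v hv)) hk (by
      have h1 : K * (D * m + 2 * m + Δ) + 3 * m + Δ ≤ 3 * (K + 1) * (D * m) + (K + 1) * Δ := by
        have : m ≤ D * m := Nat.le_mul_of_pos_left _ hD1
        nlinarith
      refine h1.trans ?_
      have hDm : (D : ℝ) * m ≤ 4 * z := by
        rw [← hxy]
        have := mul_le_mul hDx hmy (Nat.cast_nonneg m) (by linarith)
        linarith
      have hεw : (K + 1) * (ε * w) = w / C / 4 := by
        rw [hε]
        field_simp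
      -- The terms in Dm contribute 12(K + 1)z; the roundings in Δ and β cost at most (K + 1)z each.
      -- The degree term takes the remaining quarter of w/C.
      have hz : 14 * (K + 1) * z ≤ 3 / 4 * (w / C) := by
        rw [div_le_iff₀ (by positivity)] at hbig
        have h2 := mul_le_mul_of_nonneg_right hbig (by linarith : 0 ≤ z)
        have h3 : 3 * (δ * n) ≤ 3 * w := by linarith
        have h4 : 14 * (K + 1) * z * (4 * C) ≤ 3 * w := by
          refine le_trans ?_ h3
          rw [← hxz]
          linarith
        rw [show 3 / 4 * (w / C) = 3 * w / (4 * C) by field_simp]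
        exact (le_div_iff₀ (by positivity)).2 h4
      have h5 : (3 * (K + 1) * (D * m) + (K + 1) * Δ : ℝ) ≤ β := by
        have h6 : (K + 1 : ℝ) * (D * m) ≤ (K + 1) * (4 * z) :=
          mul_le_mul_of_nonneg_left hDm (by positivity)
        have h7 : (K + 1 : ℝ) * Δ ≤ (K + 1) * (ε * w + 1) :=
          mul_le_mul_of_nonneg_left hΔw (by positivity)
        have h8 : (K + 1 : ℝ) * 1 ≤ (K + 1) * z := mul_le_mul_of_nonneg_left hz1 (by positivity)
        nlinarith
      exact_mod_cast h5) (by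
      have h2 : ((2 * k + 3) * β : ℝ) ≤ W.card := by
        rw [← hC, mul_comm]
        exact (le_div_iff₀ hC0).1 hβw'
      exact_mod_cast h2)
  exact ⟨A, B, hAB, hanti, (Nat.le_ceil y).trans (by exact_mod_cast hA),
    (Nat.le_ceil y).trans (by exact_mod_cast hB)⟩

theorem IsPerfect.exists_isPurePair {c : ℝ} (hc0 : 0 < c) (hc1 : c ≤ 1) : ∃ N : ℕ, ∀ n : ℕ, N ≤ n →
    ∀ (V : Type u) [Fintype V] (G : SimpleGraph V), Fintype.card V = n → G.IsPerfect →
      ∃ A B : Finset V, G.IsPurePair A B ∧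
        (n : ℝ) ^ (1 - c) ≤ (A.card : ℝ) ∧ (n : ℝ) ^ (1 - c) ≤ (B.card : ℝ) := by
  obtain ⟨K, hK⟩ := exists_nat_ge (2 / c)
  obtain ⟨k, hk⟩ : ∃ k, k = K * (K + 1) + 1 := ⟨_, rfl⟩
  obtain ⟨δ, hδ, N₁, h₁⟩ := exists_sparse_or_dense.{u}
    (ε := 1 / (4 * (2 * k + 3) * (K + 1))) (by positivity) (by
      rw [div_le_one (by positivity)]
      have h1 : (0 : ℝ) ≤ k := Nat.cast_nonneg k
      have h2 : (0 : ℝ) ≤ K := Nat.cast_nonneg K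
      nlinarith [mul_nonneg h1 h2])
  obtain ⟨N₂, h₂⟩ := exists_anticompleteTo_of_sparse.{u} hc0 hc1 hδ hK hk
  refine ⟨max N₁ N₂, fun n hn V _ G hcard hG => ?_⟩
  have hbound := hG.cliqueIndepBound
  have hfree := hbound.oddHoleFree
  obtain ⟨W, -, hW, hdeg⟩ := h₁ V G (fun f => hfree 5 f le_rfl (by decide)) Finset.univ
    (by rw [Finset.card_univ, hcard]; exact (le_max_left _ _).trans hn)
  rw [Finset.card_univ, hcard] at hW
  have hn₂ := (le_max_right _ _).trans hn
  rcases hdeg with hdeg | hdeg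
  · obtain ⟨A, B, hAB, hanti, hA, hB⟩ := h₂ n hn₂ V G hfree W hW hdeg
    exact ⟨A, B, ⟨hAB, Or.inr hanti⟩, hA, hB⟩
  · obtain ⟨A, B, hAB, hanti, hA, hB⟩ := h₂ n hn₂ V Gᶜ hbound.compl.oddHoleFree W hW hdeg
    refine ⟨A, B, ⟨hAB, Or.inl fun a ha b hb => ?_⟩, hA, hB⟩
    by_contra hadj
    exact hanti a ha b hb ((compl_adj _ _ _).2
      ⟨fun e => Finset.disjoint_left.1 hAB ha (e ▸ hb), hadj⟩)

end SimpleGraph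

/-! ### From constant c to a vanishing sequence. -/

/-- If for every constant `c > 0` a property of `n` and `c` holds for all large `n`, then `c` can
be replaced by some sequence that tends to zero. -/
theorem exists_tendsto_zero_of_forall_pos {P : ℕ → ℝ → Prop}
    (h : ∀ c : ℝ, 0 < c → ∃ N : ℕ, ∀ n, N ≤ n → P n c) :
    ∃ δ : ℕ → ℝ, Tendsto δ atTop (𝓝 0) ∧ ∃ N : ℕ, ∀ n, N ≤ n → P n (δ n) := by
  classical
  choose N hN using fun j : ℕ => h (1 / ((j : ℝ) + 1)) Nat.one_div_pos_of_nat
  -- The largest j ≤ n whose threshold n has already passed; the cap j ≤ n keeps the search finite.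
  set g : ℕ → ℕ := fun n => Nat.findGreatest (fun j => N j ≤ n) n with hg
  refine ⟨fun n => 1 / ((g n : ℝ) + 1), ?_, N 0, fun n hn => hN _ _ ?_⟩
  · refine tendsto_one_div_add_atTop_nhds_zero_nat.comp (tendsto_atTop.2 fun J => ?_)
    filter_upwards [eventually_ge_atTop (max J (N J))] with n hn
    exact Nat.le_findGreatest ((le_max_left _ _).trans hn) ((le_max_right _ _).trans hn)
  · exact Nat.findGreatest_spec (P := fun j => N j ≤ n) (Nat.zero_le n) hn

theorem mainTheorem5 :
    (∀ c : ℝ, 0 < c → ∃ N : ℕ, ∀ n : ℕ, N ≤ n →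
      ∀ (V : Type u) [Fintype V] (G : SimpleGraph V), Fintype.card V = n → G.IsPerfect →
        ∃ A B : Finset V, G.IsPurePair A B ∧
          (n : ℝ) ^ (1 - c) ≤ (A.card : ℝ) ∧ (n : ℝ) ^ (1 - c) ≤ (B.card : ℝ)) ∧
    (∃ δ : ℕ → ℝ, Tendsto δ atTop (𝓝 0) ∧ ∃ N : ℕ, ∀ n : ℕ, N ≤ n →
      ∀ (V : Type u) [Fintype V] (G : SimpleGraph V), Fintype.card V = n → G.IsPerfect →
        ∃ A B : Finset V, G.IsPurePair A B ∧
          (n : ℝ) ^ (1 - δ n) ≤ (A.card : ℝ) ∧ (n : ℝ) ^ (1 - δ n) ≤ (B.card : ℝ)) := by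
  have h : ∀ c : ℝ, 0 < c → ∃ N : ℕ, ∀ n : ℕ, N ≤ n →
      ∀ (V : Type u) [Fintype V] (G : SimpleGraph V), Fintype.card V = n → G.IsPerfect →
        ∃ A B : Finset V, G.IsPurePair A B ∧
          (n : ℝ) ^ (1 - c) ≤ (A.card : ℝ) ∧ (n : ℝ) ^ (1 - c) ≤ (B.card : ℝ) := by
    intro c hc
    -- For c > 1 the case c = 1 is stronger, since n ≥ 1.
    obtain ⟨N, hN⟩ := SimpleGraph.IsPerfect.exists_isPurePair.{u} (c := min c 1)
      (lt_min hc one_pos) (min_le_right _ _)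
    refine ⟨max N 1, fun n hn V _ G hcard hG => ?_⟩
    obtain ⟨A, B, hAB, hA, hB⟩ := hN n ((le_max_left _ _).trans hn) V G hcard hG
    have hn1 : (1 : ℝ) ≤ n := by exact_mod_cast (le_max_right _ _).trans hn
    have hle : (n : ℝ) ^ (1 - c) ≤ (n : ℝ) ^ (1 - min c 1) :=
      Real.rpow_le_rpow_of_exponent_le hn1 (by linarith [min_le_left c 1])
    exact ⟨A, B, hAB, hle.trans hA, hle.trans hB⟩
  exact ⟨h, exists_tendsto_zero_of_forall_pos h⟩
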